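/- \textbf{Conventions.} Squares are pairs $(i,j)$ (row, column), rows numbered downwards and columns to the right. For partitions $\mu\subseteq\lambda$, let $\mathrm{Tab}(\lambda/\mu)$ be the set of skew semistandard tableaux of shape $\lambda/\mu$ with entries in $\mathbb N=\{0,1,2,\dots\}$, weakly increasing along rows and strictly increasing down columns. \emph{Coplactic operations.} Let $i\in\mathbb N$. A word over $\mathbb N$ is \emph{dominant for $i$} if each of its prefixes contains at least as many letters $i$ as letters $i+1$, and \emph{anti-dominant for $i$} if each of its suffixes contains at least as many letters $i+1$ as letters $i$. For words $w=u\,i\,v$ and $w'=u\,(i+1)\,v$ with $u$ anti-dominant for $i$ and $v$ dominant for $i$, one writes $w=e_i(w')$ and $w'=f_i(w)$. A \emph{valid reading order} for $\lambda/\mu$ is a total order $\leq_r$ on its squares such that $(i,j)\leq_r(i',j')$ whenever $i\leq i'$ and $j\geq j'$; $w_r(T)$ is the word of the entries of $T$ listed in increasing order of their squares for $\leq_r$. For $T\in\mathrm{Tab}(\lambda/\mu)$ and $c\in\{e_i,f_i\}$, $c(T)$ is defined and equal to $U$ if $U\in\mathrm{Tab}(\lambda/\mu)$, $c(w_r(T))$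 is defined, and $w_r(U)=c(w_r(T))$, where $\leq_r$ is an arbitrary valid reading order. \emph{Tableau switching.} An inward jeu de taquin slide of $T\in\mathrm{Tab}(\lambda/\mu)$ into a corner square $s$ of $\mu$ starts with the empty square $s$ and repeatedly moves into the empty square the smaller of the entries to the right of it and below it (the one below if they are equal), until there are no such entries. For $S\in\mathrm{Tab}(\mu/\nu)$ and $T\in\mathrm{Tab}(\lambda/\mu)$ one puts $X(S,T)=(T',S')$, where $T'\in\mathrm{Tab}(\mu'/\nu)$ is obtained from $T$ by successive inward slides into the squares of $S$, taken in order of decreasing entries and from right to left among equal entries, and $S'\in\mathrm{Tab}(\lambda/\mu')$ has, in the square vacated by each slide, the entry of $S$ in the square into which that slide was made. \textbf{Theorem (commutation of coplactic operations with jeu de taquin).} Let $S\in\mathrm{Tab}(\mu/\nu)$, $T\in\mathrm{Tab}(\lambda/\mu)$ and $X(S,T)=(T',S')$, and let $i\in\mathbb N$. Then, whichever valid reading orders are used to compute the coplactic operations on $T$ and on $T'$, $e_i(T)$ is defined if and only if $e_i(T')$ is defined, and in that case $$X(S,e_i(T))=(e_i(T'),S').$$ The same holds with $e_i$ replaced by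 $f_i$. -/

import Mathlib

/-!
Squares are pairs `(i, j)` = (row, column), rows numbered downwards and columns to the right,
both from `0`; this is the convention of `YoungDiagram`.  Entries of tableaux are natural numbers.
-/

/-- A skew semistandard tableau of shape `lam / mu`: entries increase weakly along rows and
strictly down columns.  The entry function is normalised to be `0` outside the shape. -/
@[ext]
structure SkewTableau (lam mu : YoungDiagram) where
  le : mu ≤ lam
  entry : ℕ × ℕ → ℕ
  row_weak : ∀ i j₁ j₂, j₁ ≤ j₂ → (i, j₁) ∉ mu → (i, j₂) ∈ lam → entry (i, j₁) ≤ entry (i, j₂)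
  col_strict : ∀ i₁ i₂ j, i₁ < i₂ → (i₁, j) ∉ mu → (i₂, j) ∈ lam → entry (i₁, j) < entry (i₂, j)
  zeros : ∀ s, ¬ (s ∈ lam ∧ s ∉ mu) → entry s = 0

/-! ### Coplactic operations on words -/

/-- Every prefix of `w` contains at least as many letters `i` as letters `i + 1`. -/
def Dominant (i : ℕ) (w : List ℕ) : Prop :=
  ∀ u, u <+: w → u.count (i + 1) ≤ u.count i

/-- Every suffix of `w` contains at least as many letters `i + 1` as letters `i`. -/
def AntiDominant (i : ℕ) (w : List ℕ) : Prop :=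
  ∀ v, v <:+ w → v.count i ≤ v.count (i + 1)

/-- The coplactic transition between `w = u i v` and `w' = u (i+1) v`, where `u` is anti-dominant
and `v` is dominant for `i`.  It means `w = e_i(w')` and `w' = f_i(w)`. -/
def CoplacticStep (i : ℕ) (w w' : List ℕ) : Prop :=
  ∃ u v, w = u ++ i :: v ∧ w' = u ++ (i + 1) :: v ∧ AntiDominant i u ∧ Dominant i v

/-! ### Coplactic operations on tableaux -/

/-- A valid reading order for `lam / mu`, given as the list of the squares in increasing order:
a total order on the squares of `lam / mu` such that `(i, j)` comes weakly before `(i', j')`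
whenever `i ≤ i'` and `j ≥ j'`.  (So if `s` is listed before `t`, then `t` is not forced to come
weakly before `s`.) -/
structure ReadingOrder (lam mu : YoungDiagram) where
  squares : List (ℕ × ℕ)
  nodup : squares.Nodup
  mem_squares : ∀ s, s ∈ squares ↔ s ∈ lam ∧ s ∉ mu
  valid : squares.Pairwise fun s t => ¬ (t.1 ≤ s.1 ∧ s.2 ≤ t.2)

/-- The word `w_r(T)` of entries of `T`, listed in the reading order `r`. -/
def ReadingOrder.word {lam mu : YoungDiagram} (r : ReadingOrder lam mu)
    (T : SkewTableau lam mu) : List ℕ :=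
  r.squares.map T.entry

/-- `e_i(T)`, computed with the reading order `r`, is defined and equal to `U`: the tableau `U`
has the same shape as `T`, and its reading word is `e_i` of the reading word of `T`. -/
def IsRaise {lam mu : YoungDiagram} (r : ReadingOrder lam mu) (i : ℕ)
    (T U : SkewTableau lam mu) : Prop :=
  CoplacticStep i (r.word U) (r.word T)

/-- `f_i(T)`, computed with the reading order `r`, is defined and equal to `U`. -/
def IsLower {lam mu : YoungDiagram} (r : ReadingOrder lam mu) (i : ℕ)
    (T U : SkewTableau lam mu) : Prop :=
  CoplacticStep i (r.word T) (r.word U)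

/-! ### Jeu de taquin and tableau switching -/

/-- A filling of some of the squares of the quadrant; `⊤` marks a square without entry. -/
abbrev Filling := ℕ × ℕ → WithTop ℕ

/-- The filling given by a skew tableau: its entries on its shape, nothing elsewhere. -/
def SkewTableau.filling {lam mu : YoungDiagram} (T : SkewTableau lam mu) : Filling :=
  fun s => if s ∈ lam ∧ s ∉ mu then (T.entry s : WithTop ℕ) else ⊤

/-- `Slide T s T' t`: the inward jeu de taquin slide of `T` into the empty square `s` results in
`T'`, and the square finally vacated is `t`.  At each step the smaller of the entries to the right
of and below the empty square moves into it, where the one below moves if they are equal (it is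
the smaller one in the standardisation); the slide ends when neither square has an entry. -/
inductive Slide : Filling → ℕ × ℕ → Filling → ℕ × ℕ → Prop
  | done (T : Filling) (i j : ℕ) (hright : T (i, j + 1) = ⊤) (hbelow : T (i + 1, j) = ⊤) :
      Slide T (i, j) T (i, j)
  | up (T T' : Filling) (i j : ℕ) (t : ℕ × ℕ) (hne : T (i + 1, j) ≠ ⊤)
      (hle : T (i + 1, j) ≤ T (i, j + 1))
      (next : Slide (Function.update (Function.update T (i, j) (T (i + 1, j))) (i + 1, j) ⊤)
        (i + 1, j) T' t) :
      Slide T (i, j) T' t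
  | left (T T' : Filling) (i j : ℕ) (t : ℕ × ℕ) (hlt : T (i, j + 1) < T (i + 1, j))
      (next : Slide (Function.update (Function.update T (i, j) (T (i, j + 1))) (i, j + 1) ⊤)
        (i, j + 1) T' t) :
      Slide T (i, j) T' t

/-- `s` is the last square of `S` in the order of its standardisation: its entry is maximal, and
it is the rightmost square with that entry. -/
def IsLastSquare (S : Filling) (s : ℕ × ℕ) : Prop :=
  S s ≠ ⊤ ∧ ∀ s', S s' ≠ ⊤ → S s' < S s ∨ (S s' = S s ∧ s'.2 ≤ s.2)

/-- Tableau switching `X(S, T) = (T', S')` on the level of fillings: `T` is slid successively into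
the squares of `S`, taken from the last one to the first one in the order of the standardisation
of `S`, which results in `T'`; the square vacated by each slide receives in `S'` the entry that
`S` has in the square into which that slide was performed. -/
inductive FillingSwitch : Filling → Filling → Filling → Filling → Prop
  | nil (T : Filling) : FillingSwitch (fun _ => ⊤) T T (fun _ => ⊤)
  | step (S T T₁ T' S' : Filling) (s t : ℕ × ℕ) (hs : IsLastSquare S s) (hslide : Slide T s T₁ t)
      (rest : FillingSwitch (Function.update S s ⊤) T₁ T' S') :
      FillingSwitch S T T' (Function.update S' t (S s))

/-- Tableau switching `X(S, T) = (T', S')` for skew semistandard tableaux `S` of shape `mu / nu`,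
`T` of shape `lam / mu`, `T'` of shape `mu' / nu` and `S'` of shape `lam / mu'`. -/
def IsSwitch {nu mu mu' lam : YoungDiagram} (S : SkewTableau mu nu) (T : SkewTableau lam mu)
    (T' : SkewTableau mu' nu) (S' : SkewTableau lam mu') : Prop :=
  FillingSwitch S.filling T.filling T'.filling S'.filling

/-! ### Patterns

A skew semistandard tableau is encoded by the numbers `A k q` of squares in row `q` that lie in
the inner shape or have an entry smaller than `k`. -/

/-! A tableau is a chain of shapes, the k-th one holding the entries smaller than k, and successive
shapes differ by horizontal strips. An inward slide removes from each shape the last square of one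
row, `slideRow A a k`. This row increases by one on passing the letter k exactly if the strip
condition is tight there. So a slide is a path of rows, and the letters i, i + 1 see only three
shapes of the chain.

The operation f_i shortens one row of the shape i + 1. Let K(q) be the number of letters i + 1 in
rows up to q minus the number of letters i in rows before q. For every valid reading order, f_i acts
on the last i of row p, where p is the last maximum of K (`IsSplitReading.dominant_iff`,
`SkewTableau.isLower_iff`). This removes words and reading orders from the problem. The operation
e_i is the inverse relation.

A slide changes K in at most one place, by one, and a neighbouring value keeps the maximum unchanged
(`pot_slidePattern_cases`). Definedness compares the maximum of K with its eventual value (for f_i)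
or with 0 (for e_i), so it passes from the slid pattern back to the original. For the other
direction the paths of A and f_i(A) are compared (`IsLastMax.slideRow_lowerAt`). They can differ
only at level i + 1, and then the row of the empty square and the row of the lowered letter are
exchanged. Hence f_i commutes with the slide and the vacated square is the same. Induction over the
slides of a switch (`FillingSwitch.compatible`) gives the theorem, with S' unchanged. -/

/-- A Gelfand–Tsetlin pattern of skew shape: successive rows `A k`, `A (k + 1)` differ by a
horizontal strip, all of them are finitely supported, and they become stationary. -/
structure IsPattern (A : ℕ → ℕ → ℕ) : Prop where
  mono : ∀ k q, A k q ≤ A (k + 1) q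
  strip : ∀ k q, A (k + 1) (q + 1) ≤ A k q
  stable : ∃ K, ∀ k, K ≤ k → A k = A K
  supp : ∀ k, ∃ Q, ∀ q, Q ≤ q → A k q = 0

theorem IsPattern.monotone {A : ℕ → ℕ → ℕ} (hA : IsPattern A) (q : ℕ) :
    Monotone fun k => A k q :=
  monotone_nat_of_le_succ fun k => hA.mono k q

theorem IsPattern.antitone {A : ℕ → ℕ → ℕ} (hA : IsPattern A) (k : ℕ) : Antitone (A k) :=
  antitone_nat_of_succ_le fun q => (hA.mono k (q + 1)).trans (hA.strip k q)

/-- The row of the empty square of the slide into the corner in row `a` of the inner shape, after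
the entries smaller than `k` have been passed. -/
def slideRow (A : ℕ → ℕ → ℕ) (a : ℕ) : ℕ → ℕ
  | 0 => a
  | k + 1 =>
    -- The empty square ends its row r in the shape `A k`. Equality means that the last k of row r +
    -- 1 stands directly below it and moves up. Otherwise the empty square runs to the end of the
    -- letters k in row r.
    if A (k + 1) (slideRow A a k + 1) = A k (slideRow A a k) then slideRow A a k + 1
    else slideRow A a k

/-- The pattern after the slide into the corner in row `a` of the inner shape. -/
def slidePattern (A : ℕ → ℕ → ℕ) (a k q : ℕ) : ℕ :=
  A k q - if q = slideRow A a k then 1 else 0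

theorem slideRow_succ (A : ℕ → ℕ → ℕ) (a k : ℕ) :
    (A (k + 1) (slideRow A a k + 1) = A k (slideRow A a k) ∧
      slideRow A a (k + 1) = slideRow A a k + 1) ∨
    (A (k + 1) (slideRow A a k + 1) ≠ A k (slideRow A a k) ∧
      slideRow A a (k + 1) = slideRow A a k) := by
  rw [slideRow]
  split_ifs with h
  · exact Or.inl ⟨h, rfl⟩
  · exact Or.inr ⟨h, rfl⟩

/-- The empty square stays a corner of the shape `A k`. In particular its row is nonempty, so the
subtraction in `slidePattern` is never truncated there. -/
theorem slideRow_corner {A : ℕ → ℕ → ℕ} (hA : IsPattern A) {a : ℕ} (ha : A 0 (a + 1) < A 0 a)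
    (k : ℕ) : A k (slideRow A a k + 1) < A k (slideRow A a k) := by
  induction k with
  | zero => exact ha
  | succ k ih =>
    have h1 := hA.strip k (slideRow A a k)
    have h2 := hA.strip k (slideRow A a k + 1)
    have h3 := hA.mono k (slideRow A a k)
    rcases slideRow_succ A a k with ⟨h, h'⟩ | ⟨h, h'⟩ <;> rw [h'] <;> omega

theorem slideRow_stable {A : ℕ → ℕ → ℕ} (hA : IsPattern A) {a : ℕ} (ha : A 0 (a + 1) < A 0 a)
    {K : ℕ} (hK : ∀ k, K ≤ k → A k = A K) (k : ℕ) (hk : K ≤ k) :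
    slideRow A a k = slideRow A a K := by
  induction k, hk using Nat.le_induction with
  | base => rfl
  | succ k hk ih =>
    have h1 := slideRow_corner hA ha k
    rcases slideRow_succ A a k with ⟨h, h'⟩ | ⟨h, h'⟩
    · rw [hK (k + 1) (by omega), ← hK k hk] at h
      omega
    · rw [h', ih]

/-- The rule for `slideRow` is what saves both inequalities: if the row stays, the strip condition
was not tight and survives the loss of a square; if it moves down, row r + 1 contains a letter k to
give up. -/
theorem isPattern_slidePattern {A : ℕ → ℕ → ℕ} (hA : IsPattern A) {a : ℕ}
    (ha : A 0 (a + 1) < A 0 a) : IsPattern (slidePattern A a) where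
  mono k q := by
    have h1 := slideRow_corner hA ha k
    have h2 := hA.mono k q
    unfold slidePattern
    rcases slideRow_succ A a k with ⟨h, h'⟩ | ⟨h, h'⟩
    · rw [h']
      by_cases hq : q = slideRow A a k + 1
      · subst hq
        simp
        omega
      · rw [if_neg hq]
        omega
    · rw [h']
      omega
  strip k q := by
    have h2 := hA.strip k q
    unfold slidePattern
    rcases slideRow_succ A a k with ⟨h, h'⟩ | ⟨h, h'⟩
    · rw [h']
      by_cases hq : q = slideRow A a k
      · subst hq
        simp
        omega
      · rw [if_neg hq]
        omega
    · rw [h']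
      by_cases hq : q = slideRow A a k
      · subst hq
        simp
        omega
      · rw [if_neg hq]
        omega
  stable := by
    obtain ⟨K, hK⟩ := hA.stable
    refine ⟨K, fun k hk => ?_⟩
    funext q
    simp only [slidePattern, slideRow_stable hA ha hK k hk, hK k hk]
  supp k := by
    obtain ⟨Q, hQ⟩ := hA.supp k
    exact ⟨Q, fun q hq => by simp [slidePattern, hQ q hq]⟩

/-! ### The potential that governs the coplactic operations -/

/-- For three successive rows `α`, `β`, `γ` of a pattern: the excess of the letters `i + 1` in
the rows up to `q` over the letters `i` in the rows before `q`. -/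
def potential (α β γ : ℕ → ℕ) (q : ℕ) : ℤ :=
  ∑ j ∈ Finset.range (q + 1), ((γ j : ℤ) - β j) - ∑ j ∈ Finset.range q, ((β j : ℤ) - α j)

theorem potential_zero (α β γ : ℕ → ℕ) : potential α β γ 0 = (γ 0 : ℤ) - β 0 := by
  simp [potential]

theorem potential_succ (α β γ : ℕ → ℕ) (q : ℕ) :
    potential α β γ (q + 1) = potential α β γ q + γ (q + 1) - β (q + 1) - β q + α q := by
  simp only [potential]
  rw [Finset.sum_range_succ _ (q + 1), Finset.sum_range_succ (fun j => ((β j : ℤ) - α j)) q]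
  ring

theorem potential_remove {α β γ α' β' γ' : ℕ → ℕ} {a b c : ℕ}
    (hα : ∀ q, (α' q : ℤ) = α q - if q = a then 1 else 0)
    (hβ : ∀ q, (β' q : ℤ) = β q - if q = b then 1 else 0)
    (hγ : ∀ q, (γ' q : ℤ) = γ q - if q = c then 1 else 0) (q : ℕ) :
    potential α' β' γ' q = potential α β γ q - (if c ≤ q then 1 else 0) + (if b ≤ q then 1 else 0)
      + (if b < q then 1 else 0) - (if a < q then 1 else 0) := by
  induction q with
  | zero =>
    rw [potential_zero, potential_zero, hβ, hγ]
    split_ifs <;> omega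
  | succ q ih =>
    rw [potential_succ, potential_succ, ih, hα, hβ, hβ, hγ]
    omega

theorem potential_lower {α β γ β' : ℕ → ℕ} {b : ℕ}
    (hβ : ∀ q, (β' q : ℤ) = β q - if q = b then 1 else 0) (q : ℕ) :
    potential α β' γ q = potential α β γ q + (if b ≤ q then 1 else 0)
      + (if b < q then 1 else 0) := by
  induction q with
  | zero =>
    rw [potential_zero, potential_zero, hβ]
    split_ifs <;> omega
  | succ q ih =>
    rw [potential_succ, potential_succ, ih, hβ, hβ]
    split_ifs <;> omega

/-- The potential of a pattern for the letters `i` and `i + 1`. -/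
def IsPattern.pot (A : ℕ → ℕ → ℕ) (i : ℕ) : ℕ → ℤ :=
  potential (A i) (A (i + 1)) (A (i + 2))

/-- `p` is the last place where `K` is maximal. -/
def IsLastMax (K : ℕ → ℤ) (p : ℕ) : Prop :=
  (∀ q, q < p → K q ≤ K p) ∧ ∀ q, p < q → K q < K p

/-- `p` is the first place where `K` is maximal. -/
def IsFirstMax (K : ℕ → ℤ) (p : ℕ) : Prop :=
  (∀ q, q < p → K q < K p) ∧ ∀ q, p < q → K q ≤ K p

theorem IsLastMax.unique {K : ℕ → ℤ} {p p' : ℕ} (h : IsLastMax K p) (h' : IsLastMax K p') :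
    p = p' := by
  rcases lt_trichotomy p p' with hlt | rfl | hlt
  · exact absurd (h.2 p' hlt) (not_lt.2 (h'.1 p hlt))
  · rfl
  · exact absurd (h'.2 p hlt) (not_lt.2 (h.1 p' hlt))

theorem IsFirstMax.unique {K : ℕ → ℤ} {p p' : ℕ} (h : IsFirstMax K p) (h' : IsFirstMax K p') :
    p = p' := by
  rcases lt_trichotomy p p' with hlt | rfl | hlt
  · exact absurd (h'.1 p hlt) (not_lt.2 (h.2 p' hlt))
  · rfl
  · exact absurd (h.1 p' hlt) (not_lt.2 (h'.2 p hlt))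

theorem exists_isLastMax {K : ℕ → ℤ} {q M : ℕ} (h : ∀ N, M ≤ N → K N < K q) :
    ∃ p, IsLastMax K p := by
  have hq : q < M := by
    by_contra hq
    exact lt_irrefl _ (h q (by omega))
  -- The lexicographic order breaks ties in K in favour of the larger index.
  obtain ⟨p, -, hp⟩ := Finset.exists_max_image (Finset.range M) (fun q => toLex (K q, q))
    ⟨q, by simpa using hq⟩
  simp only [Finset.mem_range, Prod.Lex.toLex_le_toLex] at hp
  refine ⟨p, fun q' hq' => ?_, fun q' hq' => ?_⟩
  · by_cases hM : q' < M
    · rcases hp q' hM with h1 | h1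
      · exact h1.le
      · exact h1.1.le
    · have := h q' (by omega)
      rcases hp q hq with h1 | h1 <;> omega
  · by_cases hM : q' < M
    · rcases hp q' hM with h1 | h1
      · exact h1
      · omega
    · have := h q' (by omega)
      rcases hp q hq with h1 | h1 <;> omega

theorem exists_isFirstMax {K : ℕ → ℤ} {M : ℕ} (h : ∀ N, M ≤ N → K N = K M) :
    ∃ p, IsFirstMax K p := by
  obtain ⟨p, -, hp⟩ := Finset.exists_max_image (Finset.range (M + 1))
    (fun q => toLex (K q, -(q : ℤ))) ⟨0, by simp⟩
  simp only [Finset.mem_range, Prod.Lex.toLex_le_toLex] at hp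
  have key : ∀ q, K q ≤ K p := by
    intro q
    by_cases hM : q < M + 1
    · rcases hp q hM with h1 | h1
      · exact h1.le
      · exact h1.1.le
    · rw [h q (by omega)]
      rcases hp M (by omega) with h1 | h1
      · exact h1.le
      · exact h1.1.le
  have hpM : p ≤ M ∨ K p = K M := by
    rcases le_total p M with h1 | h1
    · exact Or.inl h1
    · exact Or.inr (h p h1)
  refine ⟨p, fun q hq => lt_of_le_of_ne (key q) fun he => ?_, fun q _ => key q⟩
  by_cases hM : q < M + 1
  · rcases hp q hM with h1 | h1 <;> omega
  · have := h q (by omega)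
    rcases hp M (by omega) with h1 | h1 <;> omega

theorem potential_eventually {A : ℕ → ℕ → ℕ} (hA : IsPattern A) (i : ℕ) :
    ∃ M, ∀ N, M ≤ N → IsPattern.pot A i N = IsPattern.pot A i M := by
  obtain ⟨Q₀, h₀⟩ := hA.supp i
  obtain ⟨Q₁, h₁⟩ := hA.supp (i + 1)
  obtain ⟨Q₂, h₂⟩ := hA.supp (i + 2)
  refine ⟨Q₀ + Q₁ + Q₂, fun N hN => ?_⟩
  induction N, hN using Nat.le_induction with
  | base => rfl
  | succ N hN ih =>
    rw [← ih, IsPattern.pot, potential_succ, h₀ N (by omega), h₁ N (by omega),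
      h₁ (N + 1) (by omega), h₂ (N + 1) (by omega)]
    simp

/-- How the slide into the corner in row `a` affects the potential, in terms of the rows through
which the empty square passes. -/
theorem pot_slidePattern {A : ℕ → ℕ → ℕ} (hA : IsPattern A) {a : ℕ} (ha : A 0 (a + 1) < A 0 a)
    (i q : ℕ) :
    IsPattern.pot (slidePattern A a) i q = IsPattern.pot A i q
      - (if slideRow A a (i + 2) ≤ q then 1 else 0) + (if slideRow A a (i + 1) ≤ q then 1 else 0)
      + (if slideRow A a (i + 1) < q then 1 else 0)
      - (if slideRow A a i < q then 1 else 0) := by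
  have key : ∀ k q, ((slidePattern A a k q : ℕ) : ℤ) =
      A k q - if q = slideRow A a k then 1 else 0 := by
    intro k q
    have := slideRow_corner hA ha k
    unfold slidePattern
    split_ifs with h
    · subst h
      omega
    · simp
  exact potential_remove (key i) (key (i + 1)) (key (i + 2)) q

/-- The slide changes the potential in at most one place, and keeps its maximum. -/
theorem pot_slidePattern_cases {A : ℕ → ℕ → ℕ} (hA : IsPattern A) {a : ℕ}
    (ha : A 0 (a + 1) < A 0 a) (i : ℕ) :
    (∀ q, IsPattern.pot (slidePattern A a) i q = IsPattern.pot A i q) ∨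
    (∃ m, IsPattern.pot (slidePattern A a) i m = IsPattern.pot A i m + 1 ∧
      IsPattern.pot A i m + 1 ≤ IsPattern.pot A i (m + 1) ∧
      ∀ q, q ≠ m → IsPattern.pot (slidePattern A a) i q = IsPattern.pot A i q) ∨
    (∃ m, IsPattern.pot (slidePattern A a) i (m + 1) = IsPattern.pot A i (m + 1) - 1 ∧
      IsPattern.pot A i (m + 1) ≤ IsPattern.pot A i m ∧
      ∀ q, q ≠ m + 1 → IsPattern.pot (slidePattern A a) i q = IsPattern.pot A i q) := by
  have hpot := pot_slidePattern hA ha i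
  have hs := potential_succ (A i) (A (i + 1)) (A (i + 2)) (slideRow A a i)
  have h1 := hA.strip i (slideRow A a i)
  have h2 : A (i + 2) (slideRow A a i + 1) ≤ A (i + 1) (slideRow A a i) :=
    hA.strip (i + 1) (slideRow A a i)
  -- Does the empty square move down on the letter i, and on i + 1? If the two answers agree, the
  -- four corrections cancel.
  rcases slideRow_succ A a i with ⟨h, h'⟩ | ⟨h, h'⟩ <;>
    rcases slideRow_succ A a (i + 1) with ⟨k, k'⟩ | ⟨k, k'⟩ <;> rw [k', h'] at hpot <;>
    rw [h'] at k
  · left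
    intro q
    rw [hpot]
    split_ifs <;> omega
  · right; right
    refine ⟨slideRow A a i, ?_, ?_, fun q hq => ?_⟩
    · rw [hpot]
      split_ifs <;> omega
    · change potential _ _ _ _ ≤ potential _ _ _ _
      omega
    · rw [hpot]
      split_ifs <;> omega
  · right; left
    refine ⟨slideRow A a i, ?_, ?_, fun q hq => ?_⟩
    · rw [hpot]
      split_ifs <;> omega
    · change potential _ _ _ _ + 1 ≤ potential _ _ _ _
      rw [show i + 1 + 1 = i + 2 from rfl] at k
      omega
    · rw [hpot]
      split_ifs <;> omega
  · left
    intro q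
    rw [hpot]
    split_ifs <;> omega

theorem exists_le_pot_slidePattern {A : ℕ → ℕ → ℕ} (hA : IsPattern A) {a : ℕ}
    (ha : A 0 (a + 1) < A 0 a) (i q : ℕ) :
    ∃ q', IsPattern.pot (slidePattern A a) i q ≤ IsPattern.pot A i q' := by
  rcases pot_slidePattern_cases hA ha i with h | ⟨m, h1, h2, h3⟩ | ⟨m, h1, h2, h3⟩
  · exact ⟨q, (h q).le⟩
  · by_cases hq : q = m
    · exact ⟨m + 1, by rw [hq]; omega⟩
    · exact ⟨q, (h3 q hq).le⟩
  · by_cases hq : q = m + 1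
    · exact ⟨m, by rw [hq]; omega⟩
    · exact ⟨q, (h3 q hq).le⟩

/-! ### Lowering a pattern -/

/-- Replace the last letter `i` of row `p` by `i + 1`. -/
def lowerAt (A : ℕ → ℕ → ℕ) (i p k q : ℕ) : ℕ :=
  A k q - if k = i + 1 ∧ q = p then 1 else 0

/-- The pattern `B` results from the pattern `A` by the coplactic operation `f_i`. -/
def Lowers (i : ℕ) (A B : ℕ → ℕ → ℕ) : Prop :=
  IsPattern A ∧ ∃ p, IsLastMax (IsPattern.pot A i) p ∧ B = lowerAt A i p

theorem lowerAt_of_ne (A : ℕ → ℕ → ℕ) (i p : ℕ) {k : ℕ} (hk : k ≠ i + 1) :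
    lowerAt A i p k = A k := by
  funext q
  simp [lowerAt, hk]

theorem lowerAt_self (A : ℕ → ℕ → ℕ) (i p q : ℕ) :
    lowerAt A i p (i + 1) q = A (i + 1) q - if q = p then 1 else 0 := by
  simp [lowerAt]

/-- The strict drop of the potential from p to p + 1, combined with the pattern inequalities, shows
that row p has a letter i and that no i + 1 stands below its last one. So this letter can be
increased. -/
theorem IsLastMax.lt {A : ℕ → ℕ → ℕ} (hA : IsPattern A) {i p : ℕ}
    (hp : IsLastMax (IsPattern.pot A i) p) :
    A i p < A (i + 1) p ∧ A (i + 2) (p + 1) < A (i + 1) p := by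
  have h := hp.2 (p + 1) (by omega)
  have hs := potential_succ (A i) (A (i + 1)) (A (i + 2)) p
  have h1 := hA.strip i p
  have h2 := hA.mono (i + 1) (p + 1)
  rw [show i + 1 + 1 = i + 2 from rfl] at h2
  change potential _ _ _ _ < potential _ _ _ _ at h
  omega

theorem isPattern_lowerAt {A : ℕ → ℕ → ℕ} (hA : IsPattern A) {i p : ℕ}
    (h1 : A i p < A (i + 1) p) (h2 : A (i + 2) (p + 1) < A (i + 1) p) :
    IsPattern (lowerAt A i p) where
  mono k q := by
    have h := hA.mono k q
    unfold lowerAt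
    by_cases hk : k = i ∧ q = p
    · obtain ⟨rfl, rfl⟩ := hk
      simp
      omega
    · rw [if_neg (show ¬ (k + 1 = i + 1 ∧ q = p) by omega)]
      omega
  strip k q := by
    have h := hA.strip k q
    unfold lowerAt
    by_cases hk : k = i + 1 ∧ q = p
    · obtain ⟨rfl, rfl⟩ := hk
      simp
      rw [show i + 1 + 1 = i + 2 from rfl]
      omega
    · rw [if_neg hk]
      omega
  stable := by
    obtain ⟨K, hK⟩ := hA.stable
    refine ⟨K + i + 2, fun k hk => ?_⟩
    rw [lowerAt_of_ne _ _ _ (by omega), lowerAt_of_ne _ _ _ (by omega), hK k (by omega),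
      hK (K + i + 2) (by omega)]
  supp k := by
    obtain ⟨Q, hQ⟩ := hA.supp k
    exact ⟨Q, fun q hq => by simp [lowerAt, hQ q hq]⟩

theorem Lowers.isPattern {i : ℕ} {A B : ℕ → ℕ → ℕ} (h : Lowers i A B) : IsPattern B := by
  obtain ⟨hA, p, hp, rfl⟩ := h
  exact isPattern_lowerAt hA (hp.lt hA).1 (hp.lt hA).2

theorem Lowers.eq_of_ne {i : ℕ} {A B : ℕ → ℕ → ℕ} (h : Lowers i A B) {k : ℕ} (hk : k ≠ i + 1) :
    B k = A k := by
  obtain ⟨-, p, -, rfl⟩ := h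
  exact lowerAt_of_ne _ _ _ hk

theorem Lowers.unique {i : ℕ} {A B B' : ℕ → ℕ → ℕ} (h : Lowers i A B) (h' : Lowers i A B') :
    B = B' := by
  obtain ⟨-, p, hp, rfl⟩ := h
  obtain ⟨-, p', hp', rfl⟩ := h'
  rw [hp.unique hp']

theorem pot_lowerAt {A : ℕ → ℕ → ℕ} {i p : ℕ} (h : 0 < A (i + 1) p) (q : ℕ) :
    IsPattern.pot (lowerAt A i p) i q =
      IsPattern.pot A i q + (if p ≤ q then 1 else 0) + (if p < q then 1 else 0) := by
  unfold IsPattern.pot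
  rw [lowerAt_of_ne A i p (show i ≠ i + 1 by omega),
    lowerAt_of_ne A i p (show i + 2 ≠ i + 1 by omega)]
  refine potential_lower (fun q => ?_) q
  rw [lowerAt_self]
  split_ifs with hq
  · subst hq
    omega
  · simp

/-- Lowering raises the potential by 1 at p and by 2 beyond p, which turns the last maximum into the
first one. Hence p can be recovered from the image, and f_i is injective. -/
theorem Lowers.isFirstMax {i p : ℕ} {A : ℕ → ℕ → ℕ} (hA : IsPattern A)
    (hp : IsLastMax (IsPattern.pot A i) p) : IsFirstMax (IsPattern.pot (lowerAt A i p) i) p := by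
  have h0 := (hp.lt hA).1
  refine ⟨fun q hq => ?_, fun q hq => ?_⟩ <;> rw [pot_lowerAt (by omega), pot_lowerAt (by omega)]
  · have := hp.1 q hq
    split_ifs <;> omega
  · have := hp.2 q hq
    split_ifs <;> omega

theorem Lowers.unique_left {i : ℕ} {A A' B : ℕ → ℕ → ℕ} (h : Lowers i A B) (h' : Lowers i A' B) :
    A = A' := by
  have hne : ∀ k, k ≠ i + 1 → A k = A' k := fun k hk => by rw [← h.eq_of_ne hk, h'.eq_of_ne hk]
  obtain ⟨hA, p, hp, rfl⟩ := h
  obtain ⟨hA', p', hp', hB⟩ := h'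
  have h1 := Lowers.isFirstMax hA hp
  have h2 := Lowers.isFirstMax hA' hp'
  rw [← hB] at h2
  obtain rfl := h1.unique h2
  funext k q
  by_cases hk : k = i + 1
  · subst hk
    have h3 := congrFun (congrFun hB (i + 1)) q
    rw [lowerAt_self, lowerAt_self] at h3
    have h4 := (hp.lt hA).1
    have h5 := (hp'.lt hA').1
    by_cases hq : q = p
    · subst hq
      simp at h3
      omega
    · simpa [hq] using h3
  · rw [hne k hk]

/-- Definedness of `f_i`. -/
theorem exists_lowers_iff {A : ℕ → ℕ → ℕ} (hA : IsPattern A) (i : ℕ) :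
    (∃ B, Lowers i A B) ↔ ∃ q M, ∀ N, M ≤ N → IsPattern.pot A i N < IsPattern.pot A i q := by
  constructor
  · rintro ⟨B, -, p, hp, -⟩
    exact ⟨p, p + 1, fun N hN => hp.2 N (by omega)⟩
  · rintro ⟨q, M, h⟩
    obtain ⟨p, hp⟩ := exists_isLastMax h
    exact ⟨_, hA, p, hp, rfl⟩

/-- Replace the first letter `i + 1` of row `p` by `i`. -/
def raiseAt (A : ℕ → ℕ → ℕ) (i p k q : ℕ) : ℕ :=
  A k q + if k = i + 1 ∧ q = p then 1 else 0

/-- Definedness of `e_i`. -/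
theorem exists_raises_iff {A : ℕ → ℕ → ℕ} (hA : IsPattern A) (i : ℕ) :
    (∃ B, Lowers i B A) ↔ ∃ q, 0 < IsPattern.pot A i q := by
  constructor
  · rintro ⟨B, hB, p, hp, rfl⟩
    refine ⟨p, ?_⟩
    have h0 := (hp.lt hB).1
    rw [pot_lowerAt (by omega)]
    -- At place 0 only letters i + 1 are counted, so the maximum is nonnegative before f_i, and f_i
    -- makes it one larger.
    have h1 : 0 ≤ IsPattern.pot B i 0 := by
      have := hB.mono (i + 1) 0
      rw [IsPattern.pot, potential_zero]
      rw [show i + 1 + 1 = i + 2 from rfl] at this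
      omega
    have h2 : IsPattern.pot B i 0 ≤ IsPattern.pot B i p := by
      rcases Nat.eq_zero_or_pos p with rfl | hpos
      · exact le_rfl
      · exact hp.1 0 hpos
    split_ifs <;> omega
  · rintro ⟨q, hq⟩
    obtain ⟨M, hM⟩ := potential_eventually hA i
    obtain ⟨p, hp⟩ := exists_isFirstMax hM
    have hpos : 0 < IsPattern.pot A i p := by
      rcases lt_trichotomy p q with h | rfl | h
      · exact hq.trans_le (hp.2 q h)
      · exact hq
      · exact hq.trans (hp.1 q h)
    -- The potential is positive at p and exceeds its value at p - 1 if there is one. So row p has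
    -- an i + 1, and above its first one there is no letter i (`h2`): it may become i.
    have h1 : A (i + 1) p < A (i + 2) p := by
      cases p with
      | zero =>
        rw [IsPattern.pot, potential_zero] at hpos
        omega
      | succ p =>
        have h := hp.1 p (by omega)
        have hs := potential_succ (A i) (A (i + 1)) (A (i + 2)) p
        have h1 := hA.mono i p
        change potential _ _ _ _ < potential _ _ _ _ at h
        omega
    have h2 : ∀ p', p' + 1 = p → A (i + 1) p < A i p' := by
      rintro p' rfl
      have h := hp.1 p' (by omega)
      have hs := potential_succ (A i) (A (i + 1)) (A (i + 2)) p'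
      have h1 := hA.strip (i + 1) p'
      rw [show i + 1 + 1 = i + 2 from rfl] at h1
      change potential _ _ _ _ < potential _ _ _ _ at h
      omega
    have hB : IsPattern (raiseAt A i p) := by
      refine ⟨fun k q => ?_, fun k q => ?_, ?_, fun k => ?_⟩
      · have h := hA.mono k q
        unfold raiseAt
        by_cases hk : k = i + 1 ∧ q = p
        · obtain ⟨rfl, rfl⟩ := hk
          simp
          rw [show i + 1 + 1 = i + 2 from rfl]
          omega
        · rw [if_neg hk]
          omega
      · have h := hA.strip k q
        unfold raiseAt
        by_cases hk : k + 1 = i + 1 ∧ q + 1 = p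
        · have := h2 q hk.2
          obtain ⟨hk, rfl⟩ := hk
          obtain rfl : k = i := by omega
          simp
          omega
        · rw [if_neg hk]
          omega
      · obtain ⟨K, hK⟩ := hA.stable
        refine ⟨K + i + 2, fun k hk => ?_⟩
        funext q
        simp only [raiseAt]
        rw [if_neg (by omega), if_neg (by omega), hK k (by omega), hK (K + i + 2) (by omega)]
      · obtain ⟨Q, hQ⟩ := hA.supp k
        refine ⟨Q + p + 1, fun q hq => ?_⟩
        simp only [raiseAt]
        rw [hQ q (by omega), if_neg (by omega)]
    have hlow : lowerAt (raiseAt A i p) i p = A := by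
      funext k q
      simp only [lowerAt, raiseAt]
      omega
    have hpot := pot_lowerAt (A := raiseAt A i p) (i := i) (p := p) (by simp [raiseAt])
    rw [hlow] at hpot
    refine ⟨raiseAt A i p, hB, p, ⟨fun q hq => ?_, fun q hq => ?_⟩, hlow.symm⟩
    · have h := hp.1 q hq
      rw [hpot, hpot] at h
      split_ifs at h <;> omega
    · have h := hp.2 q hq
      rw [hpot, hpot] at h
      split_ifs at h <;> omega

/-! ### Compatibility of slides with coplactic operations -/

theorem exists_lowers_of_slidePattern {A : ℕ → ℕ → ℕ} (hA : IsPattern A) {a : ℕ}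
    (ha : A 0 (a + 1) < A 0 a) (i : ℕ) (h : ∃ B, Lowers i (slidePattern A a) B) :
    ∃ B, Lowers i A B := by
  rw [exists_lowers_iff (isPattern_slidePattern hA ha)] at h
  rw [exists_lowers_iff hA]
  obtain ⟨q, M, h⟩ := h
  obtain ⟨q', hq'⟩ := exists_le_pot_slidePattern hA ha i q
  -- Beyond all three rows of the empty square the corrections cancel: the slide keeps the eventual
  -- value of the potential.
  refine ⟨q', M + slideRow A a (i + 2) + slideRow A a (i + 1) + slideRow A a i + 1,
    fun N hN => ?_⟩
  have h1 := h N (by omega)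
  rw [pot_slidePattern hA ha, if_pos (by omega), if_pos (by omega), if_pos (by omega),
    if_pos (by omega)] at h1
  omega

theorem exists_raises_of_slidePattern {A : ℕ → ℕ → ℕ} (hA : IsPattern A) {a : ℕ}
    (ha : A 0 (a + 1) < A 0 a) (i : ℕ) (h : ∃ B, Lowers i B (slidePattern A a)) :
    ∃ B, Lowers i B A := by
  rw [exists_raises_iff (isPattern_slidePattern hA ha)] at h
  rw [exists_raises_iff hA]
  obtain ⟨q, h⟩ := h
  obtain ⟨q', hq'⟩ := exists_le_pot_slidePattern hA ha i q
  exact ⟨q', by omega⟩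

theorem slideRow_congr {A B : ℕ → ℕ → ℕ} (a : ℕ) {m : ℕ} (h : ∀ k, k ≤ m → B k = A k) :
    slideRow B a m = slideRow A a m := by
  induction m with
  | zero => rfl
  | succ m ih =>
    rw [slideRow, slideRow, ih fun k hk => h k (by omega), h m (by omega), h (m + 1) le_rfl]

theorem slideRow_congr_of_le {A B : ℕ → ℕ → ℕ} {a m : ℕ} (hm : slideRow B a m = slideRow A a m)
    (h : ∀ k, m ≤ k → B k = A k) (k : ℕ) (hk : m ≤ k) : slideRow B a k = slideRow A a k := by
  induction k, hk using Nat.le_induction with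
  | base => exact hm
  | succ k hk ih =>
    rw [slideRow, slideRow, ih, h k hk, h (k + 1) (by omega)]

/-- The rows passed by the slides of a pattern and of its image under `f_i`, and the row in which
`f_i` acts after the slide. -/
theorem IsLastMax.slideRow_lowerAt {A : ℕ → ℕ → ℕ} (hA : IsPattern A) {a : ℕ}
    (ha : A 0 (a + 1) < A 0 a) {i p : ℕ} (hp : IsLastMax (IsPattern.pot A i) p) :
    ∃ p', IsLastMax (IsPattern.pot (slidePattern A a) i) p' ∧
      slideRow (lowerAt A i p) a (i + 2) = slideRow A a (i + 2) ∧
      ((slideRow (lowerAt A i p) a (i + 1) = slideRow A a (i + 1) ∧ p' = p) ∨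
        (slideRow A a (i + 1) = p ∧ slideRow (lowerAt A i p) a (i + 1) = p')) := by
  have hpot := pot_slidePattern hA ha i
  have hpot' : ∀ q, IsPattern.pot A i (q + 1) =
      IsPattern.pot A i q + A (i + 2) (q + 1) - A (i + 1) (q + 1) - A (i + 1) q + A i q :=
    potential_succ (A i) (A (i + 1)) (A (i + 2))
  have hB0 : slideRow (lowerAt A i p) a i = slideRow A a i :=
    slideRow_congr a fun k hk => lowerAt_of_ne _ _ _ (by omega)
  have hB1 := slideRow_succ (lowerAt A i p) a i
  have hB2 := slideRow_succ (lowerAt A i p) a (i + 1)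
  have hA2 := slideRow_succ A a (i + 1)
  have hlt := hp.lt hA
  have hst : ∀ q, A (i + 2) (q + 1) ≤ A (i + 1) q := hA.strip (i + 1)
  rw [hB0, lowerAt_of_ne A i p (show i ≠ i + 1 by omega), lowerAt_self] at hB1
  rw [show i + 1 + 1 = i + 2 from rfl] at hB2 hA2
  rw [lowerAt_of_ne A i p (show i + 2 ≠ i + 1 by omega), lowerAt_self] at hB2
  generalize hr : slideRow A a i = r at *
  rcases slideRow_succ A a i with ⟨h, h'⟩ | ⟨h, h'⟩ <;> rw [hr] at h h' <;> rw [h'] at hA2 hpot ⊢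
  · rcases hA2 with ⟨k, k'⟩ | ⟨k, k'⟩ <;> rw [k'] at hpot ⊢
    -- Down on both letters: K is unchanged and K(r + 1) ≤ K(r + 2), so r + 1 is not the last
    -- maximum.
    · have hne : r + 1 ≠ p := by
        rintro rfl
        have h1 := hp.2 (r + 1 + 1) (by omega)
        have h2 := hA.strip i (r + 1)
        rw [hpot'] at h1
        omega
      rw [if_neg hne] at hB1
      have hrow : slideRow (lowerAt A i p) a (i + 1) = r + 1 := by omega
      rw [hrow, if_neg hne] at hB2
      rw [show IsPattern.pot (slidePattern A a) i = IsPattern.pot A i from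
        funext fun q => by rw [hpot]; omega]
      exact ⟨p, hp, by omega, Or.inl ⟨hrow, rfl⟩⟩
    -- Down on i only: K drops by one at r + 1.
    · replace hpot : ∀ q, IsPattern.pot (slidePattern A a) i q =
          IsPattern.pot A i q - if q = r + 1 then 1 else 0 := fun q => by
        rw [hpot]
        omega
      have hle : IsPattern.pot A i (r + 1) ≤ IsPattern.pot A i r := by
        have := hst r
        rw [hpot']
        omega
      -- This is the only case in which the paths differ. If p = r + 1, then K(r) = K(r + 1), the
      -- last maximum moves to r, and the letter below the empty square has become i + 1. So the
      -- lowered path moves down one letter later.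
      by_cases hpr : r + 1 = p
      · subst hpr
        have h1 := hp.1 r (by omega)
        rw [if_pos rfl] at hB1
        have hrow : slideRow (lowerAt A i (r + 1)) a (i + 1) = r := by omega
        rw [hrow, if_neg (by omega)] at hB2
        rw [hpot'] at h1 hle
        have := hst r
        refine ⟨r, ⟨fun q hq => ?_, fun q hq => ?_⟩, by omega, Or.inr ⟨rfl, hrow⟩⟩
        · have := hp.1 q (by omega)
          rw [hpot'] at this
          rw [hpot, hpot]
          split_ifs <;> omega
        · have h3 := hpot' r
          by_cases hq' : q = r + 1
          · subst hq'
            rw [hpot, hpot]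
            split_ifs <;> omega
          · have := hp.2 q (by omega)
            rw [hpot, hpot]
            split_ifs <;> omega
      · rw [if_neg hpr] at hB1
        have hrow : slideRow (lowerAt A i p) a (i + 1) = r + 1 := by omega
        rw [hrow, if_neg hpr] at hB2
        refine ⟨p, ⟨fun q hq => ?_, fun q hq => ?_⟩, by omega, Or.inl ⟨hrow, rfl⟩⟩
        · have := hp.1 q hq
          rw [hpot, hpot]
          split_ifs <;> omega
        · have := hp.2 q hq
          rw [hpot, hpot]
          split_ifs <;> omega
  · have h0 := hA.strip i r
    have hrow : slideRow (lowerAt A i p) a (i + 1) = r := by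
      rcases hB1 with h1 | h1
      · split_ifs at h1 <;> omega
      · exact h1.2
    rw [hrow] at hB2
    rcases hA2 with ⟨k, k'⟩ | ⟨k, k'⟩ <;> rw [k'] at hpot ⊢
    -- Down on i + 1 only: K grows by one at r, but does not exceed K(r + 1) there, so the last
    -- maximum stays.
    · replace hpot : ∀ q, IsPattern.pot (slidePattern A a) i q =
          IsPattern.pot A i q + if q = r then 1 else 0 := fun q => by
        rw [hpot]
        omega
      have hlt' : IsPattern.pot A i r < IsPattern.pot A i (r + 1) := by
        rw [hpot']
        omega
      have hne : r ≠ p := by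
        rintro rfl
        have h1 := hp.2 (r + 1) (by omega)
        omega
      rw [if_neg hne] at hB2
      refine ⟨p, ⟨fun q hq => ?_, fun q hq => ?_⟩, by omega, Or.inl ⟨hrow, rfl⟩⟩
      · have := hp.1 q hq
        by_cases hq' : q = r
        · subst hq'
          have : IsPattern.pot A i (q + 1) ≤ IsPattern.pot A i p := by
            rcases Nat.lt_or_ge (q + 1) p with h3 | h3
            · exact hp.1 _ h3
            · rw [show q + 1 = p by omega]
          rw [hpot, hpot]
          split_ifs <;> omega
        · rw [hpot, hpot]
          split_ifs <;> omega
      · have := hp.2 q hq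
        by_cases hq' : q = r
        · subst hq'
          have := hp.2 (q + 1) (by omega)
          rw [hpot, hpot]
          split_ifs <;> omega
        · rw [hpot, hpot]
          split_ifs <;> omega
    -- No move down: K is unchanged. Even if f_i shortens row r, the strict drop after the last
    -- maximum prevents a tight strip condition.
    · have hk : A (i + 2) (r + 1) ≠ A (i + 1) r - if r = p then 1 else 0 := by
        split_ifs with hrp
        · subst hrp
          have h1 := hp.2 (r + 1) (by omega)
          rw [hpot'] at h1
          omega
        · exact k
      rw [show IsPattern.pot (slidePattern A a) i = IsPattern.pot A i from
        funext fun q => by rw [hpot]; omega]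
      exact ⟨p, hp, by omega, Or.inl ⟨hrow, rfl⟩⟩

/-- The operation `f_i` commutes with slides, and preserves the final row of the empty square. -/
theorem Lowers.slidePattern {i : ℕ} {A B : ℕ → ℕ → ℕ} (h : Lowers i A B) {a : ℕ}
    (ha : A 0 (a + 1) < A 0 a) :
    Lowers i (slidePattern A a) (slidePattern B a) ∧
      ∀ k, i + 2 ≤ k → slideRow B a k = slideRow A a k := by
  obtain ⟨hA, p, hp, rfl⟩ := h
  obtain ⟨p', hp', h2, h1⟩ := hp.slideRow_lowerAt hA ha
  have hge : ∀ k, i + 2 ≤ k → slideRow (lowerAt A i p) a k = slideRow A a k :=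
    slideRow_congr_of_le h2 fun k hk => lowerAt_of_ne _ _ _ (by omega)
  refine ⟨⟨isPattern_slidePattern hA ha, p', hp', ?_⟩, hge⟩
  funext k q
  rcases lt_trichotomy k (i + 1) with hk | rfl | hk
  · rw [lowerAt_of_ne _ _ _ hk.ne, _root_.slidePattern, _root_.slidePattern,
      lowerAt_of_ne _ _ _ hk.ne,
      slideRow_congr (A := A) a fun k' hk' => lowerAt_of_ne _ _ _ (by omega)]
  · rw [lowerAt_self, _root_.slidePattern, _root_.slidePattern, lowerAt_self]
    -- In both cases the two sides lose squares in the same two rows of shape i + 1, in opposite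
    -- order.
    rcases h1 with ⟨h1, rfl⟩ | ⟨h1, h1'⟩
    · rw [h1, Nat.sub_right_comm]
    · rw [h1, h1', Nat.sub_right_comm]
  · rw [lowerAt_of_ne _ _ _ hk.ne', _root_.slidePattern, _root_.slidePattern,
      lowerAt_of_ne _ _ _ hk.ne', hge k (by omega)]

/-! ### Fillings given by patterns, and slides -/

open Classical in
/-- The filling encoded by a pattern. -/
noncomputable def fill (A : ℕ → ℕ → ℕ) : Filling := fun s =>
  if h : ∃ k, A k s.1 ≤ s.2 ∧ s.2 < A (k + 1) s.1 then ((Nat.find h : ℕ) : WithTop ℕ) else ⊤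

theorem fill_eq_coe_iff {A : ℕ → ℕ → ℕ} (hA : IsPattern A) {q j k : ℕ} :
    fill A (q, j) = (k : WithTop ℕ) ↔ A k q ≤ j ∧ j < A (k + 1) q := by
  classical
  constructor
  · intro h
    unfold fill at h
    split_ifs at h with h'
    · have h1 := Nat.find_spec h'
      rw [Nat.cast_inj.1 h] at h1
      exact h1
    · exact absurd h.symm (WithTop.natCast_ne_top k)
  · intro h
    have h' : ∃ k, A k (q, j).1 ≤ (q, j).2 ∧ (q, j).2 < A (k + 1) (q, j).1 := ⟨k, h⟩
    have h1 := Nat.find_spec h'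
    unfold fill
    rw [dif_pos h', Nat.cast_inj]
    rcases lt_trichotomy (Nat.find h') k with hlt | heq | hlt
    · have : A (Nat.find h' + 1) q ≤ A k q := hA.monotone q hlt
      exact absurd (h1.2.trans_le this) (not_lt.2 h.1)
    · exact heq
    · have : A (k + 1) q ≤ A (Nat.find h') q := hA.monotone q hlt
      exact absurd (h.2.trans_le this) (not_lt.2 h1.1)

theorem le_fill {A : ℕ → ℕ → ℕ} (hA : IsPattern A) {q j k : ℕ} (h : A k q ≤ j) :
    (k : WithTop ℕ) ≤ fill A (q, j) := by
  rcases hf : fill A (q, j) with _ | m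
  · exact le_top
  · have hm : fill A (q, j) = ((m : ℕ) : WithTop ℕ) := hf
    rw [fill_eq_coe_iff hA] at hm
    change (k : WithTop ℕ) ≤ (m : WithTop ℕ)
    rw [Nat.cast_le]
    by_contra hlt
    have : A (m + 1) q ≤ A k q := hA.monotone q (by omega)
    omega

theorem fill_eq_top_of_lt {A : ℕ → ℕ → ℕ} (hA : IsPattern A) {q j : ℕ} (h : j < A 0 q) :
    fill A (q, j) = ⊤ := by
  by_contra hne
  obtain ⟨m, hm⟩ := WithTop.ne_top_iff_exists.1 hne
  have h1 := (fill_eq_coe_iff hA).1 hm.symm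
  have : A 0 q ≤ A m q := hA.monotone q (Nat.zero_le m)
  omega

theorem fill_eq_top_of_le {A : ℕ → ℕ → ℕ} (hA : IsPattern A) {K : ℕ}
    (hK : ∀ k, K ≤ k → A k = A K) {q j : ℕ} (h : A K q ≤ j) :
    fill A (q, j) = ⊤ := by
  by_contra hne
  obtain ⟨m, hm⟩ := WithTop.ne_top_iff_exists.1 hne
  have h1 := (fill_eq_coe_iff hA).1 hm.symm
  rcases le_total K m with h2 | h2
  · rw [hK (m + 1) (by omega)] at h1
    omega
  · have : A (m + 1) q ≤ A (K + 1) q := hA.monotone q (by omega)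
    rw [hK (K + 1) (by omega)] at this
    omega

theorem fill_ne_top {A : ℕ → ℕ → ℕ} (hA : IsPattern A) {K q j : ℕ}
    (h0 : A 0 q ≤ j) (h : j < A K q) : fill A (q, j) ≠ ⊤ := by
  induction K with
  | zero => omega
  | succ K ih =>
    by_cases hj : j < A K q
    · exact ih hj
    · rw [(fill_eq_coe_iff hA).2 ⟨not_lt.1 hj, h⟩]
      exact WithTop.natCast_ne_top _

/-- A pattern is determined by its filling and its inner shape. -/
theorem eq_of_fill_eq {A B : ℕ → ℕ → ℕ} (hA : IsPattern A) (hB : IsPattern B) (h0 : A 0 = B 0)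
    (h : fill A = fill B) : A = B := by
  funext k
  induction k with
  | zero => exact h0
  | succ k ih =>
    funext q
    have key : ∀ j, A k q ≤ j → (j < A (k + 1) q ↔ j < B (k + 1) q) := fun j hj => by
      have h1 := fill_eq_coe_iff hA (q := q) (j := j) (k := k)
      rw [h, fill_eq_coe_iff hB, ← ih] at h1
      tauto
    have h1 := key (A (k + 1) q) (hA.mono k q)
    have h2 := key (B (k + 1) q) (by rw [ih]; exact hB.mono k q)
    omega

/-- The filling in the course of a slide, after the entries smaller than `k` have been passed. -/
noncomputable def slideStage (A : ℕ → ℕ → ℕ) (a k : ℕ) : Filling := fun s =>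
  if s.2 < slidePattern A a k s.1 then fill (slidePattern A a) s
  else if s.2 < A k s.1 then ⊤ else fill A s

theorem slidePattern_le (A : ℕ → ℕ → ℕ) (a k q : ℕ) : slidePattern A a k q ≤ A k q :=
  Nat.sub_le _ _

theorem slidePattern_slideRow (A : ℕ → ℕ → ℕ) (a k : ℕ) :
    slidePattern A a k (slideRow A a k) = A k (slideRow A a k) - 1 := by
  simp [slidePattern]

theorem slidePattern_of_ne {A : ℕ → ℕ → ℕ} {a k q : ℕ} (h : q ≠ slideRow A a k) :
    slidePattern A a k q = A k q := by
  simp [slidePattern, h]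

theorem slideStage_of_le {A : ℕ → ℕ → ℕ} {a k q j : ℕ} (h : A k q ≤ j) :
    slideStage A a k (q, j) = fill A (q, j) := by
  have := slidePattern_le A a k q
  simp only [slideStage]
  rw [if_neg (by omega), if_neg (by omega)]

theorem slideStage_hole {A : ℕ → ℕ → ℕ} (hA : IsPattern A) {a : ℕ}
    (ha : A 0 (a + 1) < A 0 a) (k : ℕ) :
    slideStage A a k (slideRow A a k, A k (slideRow A a k) - 1) = ⊤ := by
  have := slideRow_corner hA ha k
  simp only [slideStage]
  rw [slidePattern_slideRow, if_neg (by omega), if_pos (by omega)]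

/-- The letters `k` on the path of the slide change their places when they are passed; everything
else remains in place. -/
theorem slideStage_succ {A : ℕ → ℕ → ℕ} (hA : IsPattern A) {a : ℕ}
    (ha : A 0 (a + 1) < A 0 a) {k q j : ℕ}
    (h1 : (q, j) ≠ (slideRow A a k, A k (slideRow A a k) - 1))
    (h2 : (q, j) ≠ (slideRow A a (k + 1), A (k + 1) (slideRow A a (k + 1)) - 1)) :
    slideStage A a (k + 1) (q, j) = slideStage A a k (q, j) := by
  have hA' := isPattern_slidePattern hA ha
  have hm := hA'.mono k q
  have hm' := hA.mono k q
  have hle := slidePattern_le A a k q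
  have hle' := slidePattern_le A a (k + 1) q
  have hc := slideRow_corner hA ha k
  have hc' := slideRow_corner hA ha (k + 1)
  have hgap : slidePattern A a k q ≤ j → A k q ≤ j := fun h => by
    by_cases hq : q = slideRow A a k
    · subst hq
      rw [slidePattern_slideRow] at h
      have : j ≠ A k (slideRow A a k) - 1 := fun hj => h1 (by rw [hj])
      omega
    · rwa [slidePattern_of_ne hq] at h
  have hgap' : slidePattern A a (k + 1) q ≤ j → A (k + 1) q ≤ j := fun h => by
    by_cases hq : q = slideRow A a (k + 1)
    · subst hq
      rw [slidePattern_slideRow] at h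
      have : j ≠ A (k + 1) (slideRow A a (k + 1)) - 1 := fun hj => h2 (by rw [hj])
      omega
    · rwa [slidePattern_of_ne hq] at h
  by_cases hj : j < slidePattern A a k q
  · simp only [slideStage]
    rw [if_pos hj, if_pos (by omega)]
  · rw [slideStage_of_le (hgap (by omega))]
    by_cases hj' : j < slidePattern A a (k + 1) q
    · simp only [slideStage]
      rw [if_pos hj', (fill_eq_coe_iff hA').2 ⟨not_lt.1 hj, hj'⟩,
        (fill_eq_coe_iff hA).2 ⟨hgap (by omega), by omega⟩]
    · exact slideStage_of_le (hgap' (by omega))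

/-- With letters k to the right and larger entries below, the empty square moves right n times. The
filling in `h` is the state after these moves; each induction step prepends one of them to the
remaining slide. -/
theorem slide_horizontal {F : Filling} {a b k : ℕ} (n : ℕ)
    (hr : ∀ j, b < j → j ≤ b + n → F (a, j) = (k : WithTop ℕ))
    (hb : ∀ j, b ≤ j → (k : WithTop ℕ) < F (a + 1, j)) {F' : Filling} {t : ℕ × ℕ}
    (h : Slide (fun s => if s.1 = a ∧ b ≤ s.2 ∧ s.2 < b + n then (k : WithTop ℕ)
      else if s = (a, b + n) then ⊤ else F s) (a, b + n) F' t) :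
    Slide (fun s => if s = (a, b) then ⊤ else F s) (a, b) F' t := by
  induction n with
  | zero =>
    have he : (fun s : ℕ × ℕ => if s.1 = a ∧ b ≤ s.2 ∧ s.2 < b + 0 then (k : WithTop ℕ)
        else if s = (a, b + 0) then ⊤ else F s) = fun s => if s = (a, b) then ⊤ else F s := by
      funext s
      rw [if_neg (by omega)]
      rfl
    rwa [he] at h
  | succ n ih =>
    refine ih (fun j h1 h2 => hr j h1 (by omega)) (Slide.left _ _ _ _ _ ?_ ?_)
    · simp [hr (b + n + 1) (by omega) (by omega), hb (b + n) (by omega)]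
    · rw [← add_assoc] at h
      convert h using 1
      funext ⟨x, y⟩
      simp only [Function.update_apply, Prod.mk.injEq]
      by_cases hx : x = a
      · subst hx
        by_cases hy : y = b + n + 1
        · subst hy
          simp
        · by_cases hy' : y = b + n
          · subst hy'
            simp
            exact hr (b + n + 1) (by omega) (by omega)
          · have : (b ≤ y ∧ y < b + n) ↔ (b ≤ y ∧ y < b + (n + 1)) := by omega
            simp [this, hy, hy', ← add_assoc]
      · simp [hx]

/-- Passing the letter k is one move down or a run to the right. A `Slide` is built from its first
move, so the continuation is the hypothesis. -/
theorem slide_slideStage_of_succ {A : ℕ → ℕ → ℕ} (hA : IsPattern A) {a : ℕ}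
    (ha : A 0 (a + 1) < A 0 a) (k : ℕ) {F' : Filling} {t : ℕ × ℕ}
    (h : Slide (slideStage A a (k + 1))
      (slideRow A a (k + 1), A (k + 1) (slideRow A a (k + 1)) - 1) F' t) :
    Slide (slideStage A a k) (slideRow A a k, A k (slideRow A a k) - 1) F' t := by
  have hA' := isPattern_slidePattern hA ha
  have hsucc := fun q j => slideStage_succ hA ha (k := k) (q := q) (j := j)
  have hc := slideRow_corner hA ha k
  have hc' := slideRow_corner hA ha (k + 1)
  have hhole := slideStage_hole hA ha k
  have hhole' := slideStage_hole hA ha (k + 1)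
  have hm := hA.mono k (slideRow A a k)
  have hm' := hA.mono k (slideRow A a k + 1)
  have hs := hA.strip k (slideRow A a k)
  have hnew : slideRow A a (k + 1) ≠ slideRow A a k ∨ A k (slideRow A a k) ≠
      A (k + 1) (slideRow A a (k + 1)) → slideStage A a (k + 1)
        (slideRow A a k, A k (slideRow A a k) - 1) = (k : WithTop ℕ) := by
    intro hne
    have h1 := slidePattern_slideRow A a k
    have h2 : A k (slideRow A a k) - 1 < slidePattern A a (k + 1) (slideRow A a k) := by
      by_cases hq : slideRow A a (k + 1) = slideRow A a k
      · have := slidePattern_slideRow A a (k + 1)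
        rw [hq] at this hne
        omega
      · rw [slidePattern_of_ne (Ne.symm hq)]
        omega
    simp only [slideStage]
    rw [if_pos h2, fill_eq_coe_iff hA']
    omega
  rcases slideRow_succ A a k with ⟨he, hr⟩ | ⟨he, hr⟩
  · rw [hr] at h hsucc hhole' hc' hnew
    rw [he] at h hsucc hhole'
    generalize slideRow A a k = r at *
    obtain ⟨b, hb⟩ : ∃ b, A k r = b + 1 := ⟨A k r - 1, by omega⟩
    rw [hb] at h hsucc hhole hhole' hnew ⊢
    simp only [Nat.add_sub_cancel] at h hsucc hhole hhole' hnew ⊢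
    have hbelow : slideStage A a k (r + 1, b) = (k : WithTop ℕ) := by
      rw [slideStage_of_le (by omega), fill_eq_coe_iff hA]
      omega
    refine Slide.up _ _ _ _ _ ?_ ?_ ?_
    · rw [hbelow]
      exact WithTop.natCast_ne_top _
    -- The entry to the right is at least k, and a tie favours the square below.
    · rw [hbelow, slideStage_of_le (by omega)]
      exact le_fill hA (by omega)
    · convert h using 1
      funext ⟨x, y⟩
      by_cases h1 : (x, y) = (r + 1, b)
      · rw [h1, Function.update_self, hhole']
      · rw [Function.update_of_ne h1]
        by_cases h2 : (x, y) = (r, b)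
        · rw [h2, Function.update_self, hbelow, hnew (Or.inl (by omega))]
        · rw [Function.update_of_ne h2, hsucc x y h2 h1]
  · rw [hr] at h hsucc hhole' hc' hnew
    have hle := slidePattern_slideRow A a k
    have hle' := slidePattern_slideRow A a (k + 1)
    rw [hr] at hle'
    generalize slideRow A a k = r at *
    obtain ⟨b, hb⟩ : ∃ b, A k r = b + 1 := ⟨A k r - 1, by omega⟩
    obtain ⟨n, hn⟩ : ∃ n, A (k + 1) r = b + n + 1 := ⟨A (k + 1) r - b - 1, by omega⟩
    rw [hb] at hsucc hhole hnew ⊢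
    rw [hn] at h hsucc hhole' hnew
    simp only [Nat.add_sub_cancel] at h hsucc hhole hhole' hnew ⊢
    have heq : slideStage A a k = fun s => if s = (r, b) then ⊤ else slideStage A a k s := by
      funext s
      split_ifs with hs'
      · rw [hs', hhole]
      · rfl
    rw [heq]
    refine slide_horizontal (k := k) n (fun j h1 h2 => ?_) (fun j hj => ?_) ?_
    · rw [slideStage_of_le (by omega), fill_eq_coe_iff hA]
      omega
    · rw [slideStage_of_le (by omega)]
      -- The strip condition is not tight, so the letters k of row r + 1 end before column b.
      have : ((k + 1 : ℕ) : WithTop ℕ) ≤ fill A (r + 1, j) := le_fill hA (by omega)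
      exact lt_of_lt_of_le (Nat.cast_lt.2 (Nat.lt_succ_self k)) this
    · convert h using 1
      funext ⟨x, y⟩
      simp only
      split_ifs with h1 h2
      · obtain ⟨rfl, h1, h2⟩ := h1
        simp only [slideStage]
        rw [if_pos (by omega), eq_comm, fill_eq_coe_iff hA']
        omega
      · rw [h2, hhole']
      · by_cases h3 : (x, y) = (r, b)
        · obtain ⟨rfl, rfl⟩ := Prod.mk.inj h3
          have : n = 0 := by
            by_contra hn0
            exact h1 ⟨rfl, le_rfl, by omega⟩
          subst this
          exact absurd h3 h2
        · exact (hsucc x y h3 h2).symm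

/-- Stage 0 is the original filling and stage K the final one. At stage K the shape is stationary
and the empty square is a corner of it, so nothing is left to its right or below. -/
theorem slide_fill {A : ℕ → ℕ → ℕ} (hA : IsPattern A) {a : ℕ}
    (ha : A 0 (a + 1) < A 0 a) {K : ℕ} (hK : ∀ k, K ≤ k → A k = A K) :
    Slide (fill A) (a, A 0 a - 1) (fill (slidePattern A a))
      (slideRow A a K, A K (slideRow A a K) - 1) := by
  have hA' := isPattern_slidePattern hA ha
  have hK' : ∀ k, K ≤ k → slidePattern A a k = slidePattern A a K := fun k hk => by
    funext q
    simp only [slidePattern, hK k hk, slideRow_stable hA ha hK k hk]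
  have h0 : slideStage A a 0 = fill A := by
    funext ⟨q, j⟩
    have := slidePattern_le A a 0 q
    simp only [slideStage]
    split_ifs with h1 h2
    · rw [fill_eq_top_of_lt hA' h1, fill_eq_top_of_lt hA (by omega)]
    · rw [fill_eq_top_of_lt hA h2]
    · rfl
  have hend : slideStage A a K = fill (slidePattern A a) := by
    funext ⟨q, j⟩
    simp only [slideStage]
    split_ifs with h1 h2
    · rfl
    · rw [fill_eq_top_of_le hA' hK' (by omega)]
    · rw [fill_eq_top_of_le hA' hK' (by omega), fill_eq_top_of_le hA hK (by omega)]
  have key : ∀ k, Slide (slideStage A a k) (slideRow A a k, A k (slideRow A a k) - 1)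
      (fill (slidePattern A a)) (slideRow A a K, A K (slideRow A a K) - 1) →
      Slide (slideStage A a 0) (a, A 0 a - 1)
      (fill (slidePattern A a)) (slideRow A a K, A K (slideRow A a K) - 1) := by
    intro k
    induction k with
    | zero => exact id
    | succ k ih => exact fun h => ih (slide_slideStage_of_succ hA ha k h)
  rw [← h0]
  refine key K ?_
  have hc := slideRow_corner hA ha K
  rw [← hend]
  refine Slide.done _ _ _ ?_ ?_
  · rw [slideStage_of_le (by omega), fill_eq_top_of_le hA hK (by omega)]
  · rw [slideStage_of_le (by omega), fill_eq_top_of_le hA hK (by omega)]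

/-- The three rules exclude each other. So every slide in a given switch is the one computed by
`slide_fill`. -/
theorem Slide.unique {T T₁ T₂ : Filling} {s t₁ t₂ : ℕ × ℕ} (h₁ : Slide T s T₁ t₁)
    (h₂ : Slide T s T₂ t₂) : T₁ = T₂ ∧ t₁ = t₂ := by
  induction h₁ with
  | done T i j hr hb =>
    cases h₂ with
    | done => exact ⟨rfl, rfl⟩
    | up _ _ _ _ _ hne => exact absurd hb hne
    | left _ _ _ _ _ hlt => exact absurd (hr ▸ hlt) not_top_lt
  | up T T' i j t hne hle next ih =>
    cases h₂ with
    | done _ _ _ hr hb => exact absurd hb hne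
    | up _ _ _ _ _ _ _ nextStep => exact ih nextStep
    | left _ _ _ _ _ hlt => exact absurd hlt (not_lt.2 hle)
  | left T T' i j t hlt next ih =>
    cases h₂ with
    | done _ _ _ hr hb => exact absurd (hr ▸ hlt) not_top_lt
    | up _ _ _ _ _ _ hle => exact absurd hlt (not_lt.2 hle)
    | left _ _ _ _ _ _ nextStep => exact ih nextStep

/-! ### Switching -/

/-- The filling `S` is a semistandard tableau of the skew shape with row lengths `M / N`. -/
structure IsSkewFilling (S : Filling) (N M : ℕ → ℕ) : Prop where
  anti : Antitone N
  le : ∀ q, N q ≤ M q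
  ne_top_iff : ∀ q j, S (q, j) ≠ ⊤ ↔ N q ≤ j ∧ j < M q
  row : ∀ q j, S (q, j) ≠ ⊤ → S (q, j + 1) ≠ ⊤ → S (q, j) ≤ S (q, j + 1)
  col : ∀ q j, S (q, j) ≠ ⊤ → S (q + 1, j) ≠ ⊤ → S (q, j) < S (q + 1, j)

theorem IsSkewFilling.eq_of_top {N M : ℕ → ℕ} (h : IsSkewFilling (fun _ => ⊤) N M) : M = N := by
  funext q
  have h1 := h.le q
  have h2 := h.ne_top_iff q (N q)
  simp at h2
  omega

/-- The last square of a tableau is a corner of its outer shape. -/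
theorem IsSkewFilling.last {S : Filling} {N M : ℕ → ℕ} (h : IsSkewFilling S N M) {a b : ℕ}
    (hs : IsLastSquare S (a, b)) : M a = b + 1 ∧ M (a + 1) ≤ b := by
  obtain ⟨hne, hlast⟩ := hs
  have h1 := (h.ne_top_iff a b).1 hne
  constructor
  · by_contra hM
    have h2 : S (a, b + 1) ≠ ⊤ := (h.ne_top_iff _ _).2 (by omega)
    have h3 := h.row a b hne h2
    rcases hlast _ h2 with h4 | h4
    · exact absurd h4 (not_lt.2 h3)
    · simp at h4
  · by_contra hM
    have h5 : N (a + 1) ≤ N a := h.anti (Nat.le_succ a)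
    have h2 : S (a + 1, b) ≠ ⊤ := (h.ne_top_iff _ _).2 (by omega)
    have h3 := h.col a b hne h2
    rcases hlast _ h2 with h4 | h4
    · exact absurd h4 (not_lt.2 h3.le)
    · exact h3.ne' h4.1

theorem IsSkewFilling.remove {S : Filling} {N M M' : ℕ → ℕ} (h : IsSkewFilling S N M) {a b : ℕ}
    (hs : IsLastSquare S (a, b)) (hM' : ∀ q, M' q = M q - if q = a then 1 else 0) :
    IsSkewFilling (Function.update S (a, b) ⊤) N M' := by
  have hlast := h.last hs
  have hab := (h.ne_top_iff a b).1 hs.1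
  have hne : ∀ q j, Function.update S (a, b) ⊤ (q, j) ≠ ⊤ →
      Function.update S (a, b) ⊤ (q, j) = S (q, j) ∧ S (q, j) ≠ ⊤ := by
    intro q j hq
    by_cases he : (q, j) = (a, b)
    · rw [he, Function.update_self] at hq
      exact absurd rfl hq
    · rw [Function.update_of_ne he] at hq ⊢
      exact ⟨rfl, hq⟩
  refine ⟨h.anti, fun q => ?_, fun q j => ?_, fun q j h1 h2 => ?_, fun q j h1 h2 => ?_⟩
  · have := h.le q
    rw [hM']
    split_ifs with hq
    · subst hq
      omega
    · omega
  · by_cases he : (q, j) = (a, b)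
    · obtain ⟨rfl, rfl⟩ := Prod.mk.inj he
      rw [Function.update_self, hM', if_pos rfl]
      simp
      omega
    · rw [Function.update_of_ne he, h.ne_top_iff, hM']
      split_ifs with hq
      · subst hq
        have : j ≠ b := fun hj => he (by rw [hj])
        omega
      · rfl
  · rw [(hne _ _ h1).1, (hne _ _ h2).1]
    exact h.row _ _ (hne _ _ h1).2 (hne _ _ h2).2
  · rw [(hne _ _ h1).1, (hne _ _ h2).1]
    exact h.col _ _ (hne _ _ h1).2 (hne _ _ h2).2

/-- A relation between patterns that commutes with slides. -/
def SlideCompatible (R : (ℕ → ℕ → ℕ) → (ℕ → ℕ → ℕ) → Prop) : Prop :=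
  ∀ A a, IsPattern A → A 0 (a + 1) < A 0 a →
    ((∃ B, R (slidePattern A a) B) → ∃ B, R A B) ∧
    ∀ B, R A B → IsPattern B ∧ B 0 = A 0 ∧ R (slidePattern A a) (slidePattern B a) ∧
      ∃ K, ∀ k, K ≤ k → B k = A k ∧ slideRow B a k = slideRow A a k

theorem slideCompatible_lowers (i : ℕ) : SlideCompatible (Lowers i) := by
  intro A a hA ha
  refine ⟨exists_lowers_of_slidePattern hA ha i, fun B hB => ?_⟩
  obtain ⟨h1, h2⟩ := hB.slidePattern ha
  exact ⟨hB.isPattern, hB.eq_of_ne (by omega), h1, i + 2,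
    fun k hk => ⟨hB.eq_of_ne (by omega), h2 k hk⟩⟩

/-- Commutation is that of f_i, applied to `B` instead of `A`; only definedness needs an argument of
its own. -/
theorem slideCompatible_raises (i : ℕ) : SlideCompatible fun A B => Lowers i B A := by
  intro A a hA ha
  refine ⟨exists_raises_of_slidePattern hA ha i, fun B hB => ?_⟩
  have h0 := hB.eq_of_ne (k := 0) (by omega)
  rw [h0] at ha
  obtain ⟨h1, h2⟩ := hB.slidePattern ha
  exact ⟨hB.1, h0.symm, h1, i + 2,
    fun k hk => ⟨(hB.eq_of_ne (by omega)).symm, (h2 k hk).symm⟩⟩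

/-- A relation that commutes with slides commutes with switching. -/
theorem FillingSwitch.compatible {R : (ℕ → ℕ → ℕ) → (ℕ → ℕ → ℕ) → Prop}
    (hR : SlideCompatible R) {S T T' S' : Filling} (h : FillingSwitch S T T' S') :
    ∀ {A : ℕ → ℕ → ℕ} {N : ℕ → ℕ}, IsPattern A → T = fill A → IsSkewFilling S N (A 0) →
    ∃ A', IsPattern A' ∧ T' = fill A' ∧ A' 0 = N ∧ ((∃ B', R A' B') → ∃ B, R A B) ∧
      ∀ B, R A B → ∃ B', R A' B' ∧ FillingSwitch S (fill B) (fill B') S' := by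
  induction h with
  | nil T =>
    intro A N hA hT hS
    exact ⟨A, hA, hT, hS.eq_of_top, id, fun B hB => ⟨B, hB, FillingSwitch.nil _⟩⟩
  | step S T T₁ T' S' s t hs hslide rest ih =>
    intro A N hA hT hS
    obtain ⟨a, b⟩ := s
    obtain ⟨hb, ha'⟩ := hS.last hs
    have ha : A 0 (a + 1) < A 0 a := by omega
    obtain ⟨KA, hKA⟩ := hA.stable
    have hsl := slide_fill hA ha hKA
    rw [hb, Nat.add_sub_cancel, ← hT] at hsl
    obtain ⟨h1, h2⟩ := hslide.unique hsl
    obtain ⟨A', hA', hT', hN, hex, hcomm⟩ := ih (isPattern_slidePattern hA ha) h1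
      (hS.remove hs fun q => rfl)
    obtain ⟨hR1, hR2⟩ := hR A a hA ha
    refine ⟨A', hA', hT', hN, fun h => hR1 (hex h), fun B hB => ?_⟩
    obtain ⟨hBp, hB0, hB1, K, hK⟩ := hR2 B hB
    obtain ⟨B', hB', hsw⟩ := hcomm _ hB1
    refine ⟨B', hB', FillingSwitch.step S (fill B) _ _ _ (a, b) t hs ?_ hsw⟩
    have hKB : ∀ k, KA + K ≤ k → B k = B (KA + K) := fun k hk => by
      rw [(hK k (by omega)).1, (hK (KA + K) (by omega)).1, hKA k (by omega),
        hKA (KA + K) (by omega)]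
    have hslB := slide_fill hBp (a := a) (by rwa [hB0]) hKB
    -- The vacated square depends only on late rows of the pattern and of the path, where A and B
    -- agree.
    rw [hB0, hb, Nat.add_sub_cancel, (hK _ (by omega)).1, (hK _ (by omega)).2,
      hKA _ (by omega), slideRow_stable hA ha hKA _ (by omega), ← h2] at hslB
    exact hslB

/-! ### Reading words -/

/-- The squares in the rows `m ≤ q < n` of the strip `β / α`. -/
def rowStrip (α β : ℕ → ℕ) (m n : ℕ) : Finset (ℕ × ℕ) :=
  ((Finset.Ico m n).sigma fun q => Finset.Ico (α q) (β q)).map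
    (Equiv.sigmaEquivProd ℕ ℕ).toEmbedding

theorem mem_rowStrip {α β : ℕ → ℕ} {m n q j : ℕ} :
    (q, j) ∈ rowStrip α β m n ↔ (m ≤ q ∧ q < n) ∧ α q ≤ j ∧ j < β q := by
  simp [rowStrip]

theorem card_rowStrip (α β : ℕ → ℕ) (m n : ℕ) :
    (rowStrip α β m n).card = ∑ q ∈ Finset.Ico m n, (β q - α q) := by
  simp [rowStrip]

/-- Turns comparisons of potentials into counts of squares, the form in which dominance of words
enters. -/
theorem potential_sub_potential {α β γ : ℕ → ℕ} (h1 : ∀ q, α q ≤ β q) (h2 : ∀ q, β q ≤ γ q)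
    {m n : ℕ} (hmn : m ≤ n) :
    potential α β γ n - potential α β γ m =
      ((rowStrip β γ (m + 1) (n + 1)).card : ℤ) - (rowStrip α β m n).card := by
  rw [card_rowStrip, card_rowStrip]
  induction n, hmn using Nat.le_induction with
  | base => simp
  | succ n hmn ih =>
    rw [potential_succ, Finset.sum_Ico_succ_top (show m + 1 ≤ n + 1 by omega),
      Finset.sum_Ico_succ_top (show m ≤ n by omega)]
    have := h1 n
    have := h2 (n + 1)
    push_cast [Nat.cast_sub, h1 n, h2 (n + 1)] at ih ⊢
    linarith

theorem count_map_eq_card {e : ℕ × ℕ → ℕ} {l : List (ℕ × ℕ)} (hl : l.Nodup) (k : ℕ) :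
    (l.map e).count k = (l.toFinset.filter fun s => e s = k).card := by
  induction l with
  | nil => simp
  | cons a l ih =>
    rw [List.nodup_cons] at hl
    rw [List.map_cons, List.count_cons, ih hl.2, List.toFinset_cons, Finset.filter_insert]
    by_cases h : e a = k
    · rw [if_pos h, Finset.card_insert_of_notMem (by simp [hl.1])]
      simp [h]
    · simp [h]

/-- A reading of the letters `i` and `i + 1` of a pattern, split at the last letter `i` in row
`p`. -/
structure IsSplitReading (A : ℕ → ℕ → ℕ) (i p : ℕ) (e : ℕ × ℕ → ℕ) (l₁ l₂ : List (ℕ × ℕ)) :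
    Prop where
  pattern : IsPattern A
  lt : A i p < A (i + 1) p
  nodup : (l₁ ++ (p, A (i + 1) p - 1) :: l₂).Nodup
  valid : (l₁ ++ (p, A (i + 1) p - 1) :: l₂).Pairwise fun s t => ¬ (t.1 ≤ s.1 ∧ s.2 ≤ t.2)
  mem_fst : ∀ q j, (q, j) ∈ l₁ ++ (p, A (i + 1) p - 1) :: l₂ ∧ e (q, j) = i ↔
    A i q ≤ j ∧ j < A (i + 1) q
  mem_snd : ∀ q j, (q, j) ∈ l₁ ++ (p, A (i + 1) p - 1) :: l₂ ∧ e (q, j) = i + 1 ↔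
    A (i + 1) q ≤ j ∧ j < A (i + 2) q

namespace IsSplitReading

variable {A : ℕ → ℕ → ℕ} {i p : ℕ} {e : ℕ × ℕ → ℕ} {l₁ l₂ : List (ℕ × ℕ)}

theorem mem_left (h : IsSplitReading A i p e l₁ l₂) {q j : ℕ} (hm : (q, j) ∈ l₁) :
    q < p ∨ A (i + 1) p ≤ j := by
  have h1 := (List.pairwise_append.1 h.valid).2.2 _ hm _ List.mem_cons_self
  have h2 := h.lt
  simp only at h1
  omega

theorem mem_right (h : IsSplitReading A i p e l₁ l₂) {q j : ℕ} (hm : (q, j) ∈ l₂) :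
    p < q ∨ j + 1 < A (i + 1) p := by
  have h1 := (List.pairwise_cons.1 (List.pairwise_append.1 h.valid).2.1).1 _ hm
  have h2 := h.lt
  simp only at h1
  omega

theorem mem_left_of (h : IsSplitReading A i p e l₁ l₂) {q j : ℕ}
    (hm : (q, j) ∈ l₁ ++ (p, A (i + 1) p - 1) :: l₂) (hq : q ≤ p) (hj : A (i + 1) p ≤ j) :
    (q, j) ∈ l₁ := by
  have h2 := h.lt
  rcases List.mem_append.1 hm with h1 | h1
  · exact h1
  · rcases List.mem_cons.1 h1 with h1 | h1
    · have := (Prod.mk.inj h1).2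
      omega
    · have := h.mem_right h1
      omega

theorem mem_right_of (h : IsSplitReading A i p e l₁ l₂) {q j : ℕ}
    (hm : (q, j) ∈ l₁ ++ (p, A (i + 1) p - 1) :: l₂) (hq : p ≤ q) (hj : j < A (i + 1) p)
    (hne : (q, j) ≠ (p, A (i + 1) p - 1)) : (q, j) ∈ l₂ := by
  rcases List.mem_append.1 hm with h1 | h1
  · have := h.mem_left h1
    omega
  · exact (List.mem_cons.1 h1).resolve_left hne

theorem mem_of_left (_h : IsSplitReading A i p e l₁ l₂) {x : ℕ × ℕ} (hx : x ∈ l₁) :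
    x ∈ l₁ ++ (p, A (i + 1) p - 1) :: l₂ :=
  List.mem_append_left _ hx

theorem mem_of_right (_h : IsSplitReading A i p e l₁ l₂) {x : ℕ × ℕ} (hx : x ∈ l₂) :
    x ∈ l₁ ++ (p, A (i + 1) p - 1) :: l₂ :=
  List.mem_append_right _ (List.mem_cons_of_mem _ hx)

theorem valid_right (h : IsSplitReading A i p e l₁ l₂) :
    l₂.Pairwise fun s t => ¬ (t.1 ≤ s.1 ∧ s.2 ≤ t.2) :=
  (List.pairwise_cons.1 (List.pairwise_append.1 h.valid).2.1).2

theorem valid_left (h : IsSplitReading A i p e l₁ l₂) :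
    l₁.Pairwise fun s t => ¬ (t.1 ≤ s.1 ∧ s.2 ≤ t.2) :=
  (List.pairwise_append.1 h.valid).1

theorem nodup_left (h : IsSplitReading A i p e l₁ l₂) : l₁.Nodup :=
  (List.nodup_append.1 h.nodup).1

theorem nodup_right (h : IsSplitReading A i p e l₁ l₂) : l₂.Nodup :=
  (List.nodup_cons.1 (List.nodup_append.1 h.nodup).2.1).2

theorem pot_sub_pot (h : IsSplitReading A i p e l₁ l₂) {m n : ℕ} (hmn : m ≤ n) :
    IsPattern.pot A i n - IsPattern.pot A i m =
      ((rowStrip (A (i + 1)) (A (i + 2)) (m + 1) (n + 1)).card : ℤ) -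
        (rowStrip (A i) (A (i + 1)) m n).card :=
  potential_sub_potential (h.pattern.mono i) (h.pattern.mono (i + 1)) hmn

/-- Dominance is applied to the prefix ending with the first i + 1 of row c. It contains all letters
i + 1 of rows p + 1 to c, while its letters i lie in rows p to c - 1 and omit the split square; this
omission makes the inequality strict. -/
theorem pot_lt_of_dominant_of_lt (h : IsSplitReading A i p e l₁ l₂)
    (hd : Dominant i (l₂.map e)) {c : ℕ} (hc : p < c) (hlt : A (i + 1) c < A (i + 2) c) :
    IsPattern.pot A i c < IsPattern.pot A i p := by
  have hA := h.pattern
  have hst : ∀ q, p < q → A (i + 2) q ≤ A (i + 1) p := fun q hq => by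
    obtain ⟨q, rfl⟩ : ∃ q', q = q' + 1 := ⟨q - 1, by omega⟩
    exact (hA.strip (i + 1) q).trans (hA.antitone (i + 1) (by omega))
  have ht := (h.mem_snd c (A (i + 1) c)).2 ⟨le_rfl, hlt⟩
  have ht₂ := h.mem_right_of ht.1 hc.le (by have := hst c hc; omega) (by simp; omega)
  obtain ⟨P₁, P₂, hP⟩ := List.append_of_mem ht₂
  have hval := h.valid_right
  have hnd := h.nodup_right
  rw [hP] at hval hnd
  have hcount := hd ((P₁ ++ [(c, A (i + 1) c)]).map e) ⟨P₂.map e, by simp [hP]⟩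
  have hnd' : (P₁ ++ [(c, A (i + 1) c)]).Nodup :=
    hnd.sublist ((List.singleton_sublist.2 List.mem_cons_self).append_left P₁)
  rw [count_map_eq_card hnd', count_map_eq_card hnd'] at hcount
  obtain ⟨-, hval₂, hval₁⟩ := List.pairwise_append.1 hval
  have hsub₁ : rowStrip (A (i + 1)) (A (i + 2)) (p + 1) (c + 1) ⊆
      (P₁ ++ [(c, A (i + 1) c)]).toFinset.filter fun s => e s = i + 1 := by
    rintro ⟨q, j⟩ hx
    rw [mem_rowStrip] at hx
    obtain ⟨hq, hx⟩ := hx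
    have hx' := (h.mem_snd q j).2 hx
    have h2 := h.mem_right_of hx'.1 (by omega) (by have := hst q (by omega); omega)
      (by simp; omega)
    rw [hP, List.append_cons] at h2
    rw [Finset.mem_filter, List.mem_toFinset]
    refine ⟨(List.mem_append.1 h2).resolve_right fun h3 => ?_, hx'.2⟩
    have h4 := (List.pairwise_cons.1 hval₂).1 _ h3
    have h5 : A (i + 1) c ≤ A (i + 1) q := hA.antitone (i + 1) (by omega)
    simp only at h4
    omega
  have hsub₂ : ((P₁ ++ [(c, A (i + 1) c)]).toFinset.filter fun s => e s = i) ⊆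
      (rowStrip (A i) (A (i + 1)) p c).erase (p, A (i + 1) p - 1) := by
    rintro ⟨q, j⟩ hx
    rw [Finset.mem_filter, List.mem_toFinset] at hx
    obtain ⟨hx, hxe⟩ := hx
    have h2 : (q, j) ∈ l₂ := by
      rw [hP, List.append_cons]
      exact List.mem_append_left _ hx
    have h3 := (h.mem_fst q j).1 ⟨h.mem_of_right h2, hxe⟩
    have h4 := h.mem_right h2
    -- Letters i above row p stand to the right of the split square and are read before it.
    have hqp : p ≤ q := by
      by_contra hq
      have h5 := hA.strip i q
      have h6 : A (i + 1) p ≤ A (i + 1) (q + 1) := hA.antitone (i + 1) (by omega)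
      omega
    have hqc : q < c := by
      by_contra hq
      have h5 : A (i + 1) q ≤ A (i + 1) c := hA.antitone (i + 1) (by omega)
      rcases List.mem_append.1 hx with h6 | h6
      · have h7 := hval₁ _ h6 _ List.mem_cons_self
        simp only at h7
        omega
      · rw [List.mem_singleton.1 h6] at hxe
        omega
    rw [Finset.mem_erase, mem_rowStrip]
    refine ⟨fun he => ?_, ⟨hqp, hqc⟩, h3⟩
    obtain ⟨rfl, rfl⟩ := Prod.mk.inj he
    omega
  have hs : (p, A (i + 1) p - 1) ∈ rowStrip (A i) (A (i + 1)) p c := by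
    have := h.lt
    rw [mem_rowStrip]
    omega
  have h1 := Finset.card_le_card hsub₁
  have h2 := Finset.card_le_card hsub₂
  have h3 := Finset.card_erase_lt_of_mem hs
  have h4 := h.pot_sub_pot hc.le
  omega

/-- A row without letters i + 1 cannot increase the potential, so only rows with such a letter need
the dominance argument. -/
theorem pot_lt_of_dominant (h : IsSplitReading A i p e l₁ l₂) (hd : Dominant i (l₂.map e))
    {c : ℕ} (hc : p < c) : IsPattern.pot A i c < IsPattern.pot A i p := by
  have hs : ∀ q, IsPattern.pot A i (q + 1) =
      IsPattern.pot A i q + A (i + 2) (q + 1) - A (i + 1) (q + 1) - A (i + 1) q + A i q :=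
    potential_succ (A i) (A (i + 1)) (A (i + 2))
  induction c, hc using Nat.le_induction with
  | base =>
    by_cases hlt : A (i + 1) (p + 1) < A (i + 2) (p + 1)
    · exact h.pot_lt_of_dominant_of_lt hd (Nat.lt_succ_self p) hlt
    · have := h.lt
      change IsPattern.pot A i (p + 1) < IsPattern.pot A i p
      rw [hs p]
      omega
  | succ c hc ih =>
    by_cases hlt : A (i + 1) (c + 1) < A (i + 2) (c + 1)
    · exact h.pot_lt_of_dominant_of_lt hd (by omega) hlt
    · have := h.pattern.mono i c
      have := hs c
      omega

/-- Let (c, d) be the lowest, then leftmost, i + 1 of the prefix. The letters i that the prefix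
lacks in rows p to c - 1, apart from the split square, stand in row c - 1, above letters i + 1 of
row c to the left of d, which it lacks as well. So the bound on the potential at c carries over. -/
theorem dominant_of_pot_lt (h : IsSplitReading A i p e l₁ l₂)
    (hK : ∀ c, p < c → IsPattern.pot A i c < IsPattern.pot A i p) : Dominant i (l₂.map e) := by
  rintro u ⟨v, huv⟩
  obtain ⟨P, R, hP, rfl, -⟩ := List.map_eq_append_iff.1 huv.symm
  have hA := h.pattern
  have hval := h.valid_right
  have hnd : P.Nodup := (List.nodup_append.1 (hP ▸ h.nodup_right)).1
  rw [hP] at hval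
  rw [count_map_eq_card hnd, count_map_eq_card hnd]
  have hPl : ∀ {x}, x ∈ P → x ∈ l₂ := fun hx => hP ▸ List.mem_append_left _ hx
  rcases (P.toFinset.filter fun s => e s = i + 1).eq_empty_or_nonempty with h0 | h0
  · rw [h0]
    simp
  obtain ⟨⟨c, d⟩, ht, hmax⟩ := Finset.exists_max_image _
    (fun s : ℕ × ℕ => toLex (s.1, -(s.2 : ℤ))) h0
  simp only [Finset.mem_filter, List.mem_toFinset, Prod.Lex.toLex_le_toLex] at ht hmax
  have htA := (h.mem_snd c d).1 ⟨h.mem_of_right (hPl ht.1), ht.2⟩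
  have hrow : ∀ {q j}, (q, j) ∈ P → e (q, j) = i + 1 → p < q := fun {q j} hx hxe => by
    have h1 := h.mem_right (hPl hx)
    have h2 := (h.mem_snd q j).1 ⟨h.mem_of_right (hPl hx), hxe⟩
    by_contra hq
    have h3 : A (i + 1) p ≤ A (i + 1) q := hA.antitone (i + 1) (by omega)
    omega
  have hpc := hrow ht.1 ht.2
  have hsub₁ : (P.toFinset.filter fun s => e s = i + 1) ∪
      rowStrip (A (i + 1)) (fun _ => d) c (c + 1) ⊆
      rowStrip (A (i + 1)) (A (i + 2)) (p + 1) (c + 1) := by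
    rintro ⟨q, j⟩ hx
    rw [Finset.mem_union, Finset.mem_filter, List.mem_toFinset, mem_rowStrip] at hx
    rw [mem_rowStrip]
    rcases hx with ⟨hx, hxe⟩ | hx
    · have h1 := hmax _ ⟨hx, hxe⟩
      have h2 := (h.mem_snd q j).1 ⟨h.mem_of_right (hPl hx), hxe⟩
      have h3 := hrow hx hxe
      simp only at h1
      omega
    · obtain rfl : q = c := by omega
      omega
  have hdisj : Disjoint (P.toFinset.filter fun s => e s = i + 1)
      (rowStrip (A (i + 1)) (fun _ => d) c (c + 1)) := by
    rw [Finset.disjoint_left]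
    rintro ⟨q, j⟩ hx hx'
    rw [Finset.mem_filter, List.mem_toFinset] at hx
    rw [mem_rowStrip] at hx'
    have h1 := hmax _ hx
    simp only at h1
    omega
  have hsub₂ : (rowStrip (A i) (A (i + 1)) p c).erase (p, A (i + 1) p - 1) ⊆
      (P.toFinset.filter fun s => e s = i) ∪
        rowStrip (fun _ => A (i + 1) c) (fun _ => d) (c - 1) c := by
    rintro ⟨q, j⟩ hx
    rw [Finset.mem_erase, mem_rowStrip] at hx
    obtain ⟨hne, hq, hx⟩ := hx
    rw [Finset.mem_union, Finset.mem_filter, List.mem_toFinset, mem_rowStrip]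
    obtain ⟨c, rfl⟩ : ∃ c', c = c' + 1 := ⟨c - 1, by omega⟩
    by_cases hj : d ≤ j
    · left
      have hx' := (h.mem_fst q j).2 hx
      have h1 : A (i + 1) q ≤ A (i + 1) p := hA.antitone (i + 1) hq.1
      have h2 := h.mem_right_of hx'.1 hq.1 (by omega) hne
      rw [hP] at h2
      refine ⟨(List.mem_append.1 h2).resolve_right fun h3 => ?_, hx'.2⟩
      have h4 := (List.pairwise_append.1 hval).2.2 _ ht.1 _ h3
      simp only at h4
      omega
    · right
      have h1 := hA.strip i q
      have h2 := hA.strip i c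
      have h3 : A (i + 2) (c + 1) ≤ A (i + 1) c := hA.strip (i + 1) c
      -- Letters i of a row above c begin no earlier than column `A (i + 1) c`, which is beyond d.
      have h4 : q = c := by
        by_contra hqc
        have h5 : A (i + 1) c ≤ A (i + 1) (q + 1) := hA.antitone (i + 1) (by omega)
        omega
      subst h4
      omega
  have hs : (p, A (i + 1) p - 1) ∈ rowStrip (A i) (A (i + 1)) p c := by
    have := h.lt
    rw [mem_rowStrip]
    omega
  have h1 := Finset.card_le_card hsub₁
  have h2 := (Finset.card_le_card hsub₂).trans (Finset.card_union_le _ _)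
  have h3 := Finset.card_erase_add_one hs
  have h4 := h.pot_sub_pot hpc.le
  have h5 := hK c hpc
  rw [Finset.card_union_of_disjoint hdisj, card_rowStrip (A (i + 1)) (fun _ => d)] at h1
  rw [card_rowStrip (fun _ => A (i + 1) c)] at h2
  obtain ⟨c, rfl⟩ : ∃ c', c = c' + 1 := ⟨c - 1, by omega⟩
  simp at h1 h2
  omega

/-- Mirror image of `pot_lt_of_dominant_of_lt`, for the suffix starting with the last i of row c. No
square is omitted here, so the inequality is weak. -/
theorem pot_le_of_antiDominant_of_lt (h : IsSplitReading A i p e l₁ l₂)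
    (hd : AntiDominant i (l₁.map e)) {c : ℕ} (hc : c < p) (hlt : A i c < A (i + 1) c) :
    IsPattern.pot A i c ≤ IsPattern.pot A i p := by
  have hA := h.pattern
  have hst : ∀ q, q < p → A (i + 1) p ≤ A i q := fun q hq =>
    (hA.antitone (i + 1) hq).trans (hA.strip i q)
  have ht := (h.mem_fst c (A (i + 1) c - 1)).2 (by omega)
  have ht₁ := h.mem_left_of ht.1 hc.le (by have := hst c hc; omega)
  obtain ⟨P₁, P₂, hP⟩ := List.append_of_mem ht₁
  have hval := h.valid_left
  have hnd := h.nodup_left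
  rw [hP] at hval hnd
  have hcount := hd (((c, A (i + 1) c - 1) :: P₂).map e) ⟨P₁.map e, by simp [hP]⟩
  have hnd' := (List.nodup_append.1 hnd).2.1
  rw [count_map_eq_card hnd', count_map_eq_card hnd'] at hcount
  obtain ⟨-, hval₂, hval₁⟩ := List.pairwise_append.1 hval
  have hsub₁ : rowStrip (A i) (A (i + 1)) c p ⊆
      ((c, A (i + 1) c - 1) :: P₂).toFinset.filter fun s => e s = i := by
    rintro ⟨q, j⟩ hx
    rw [mem_rowStrip] at hx
    obtain ⟨hq, hx⟩ := hx
    have hx' := (h.mem_fst q j).2 hx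
    have h2 := h.mem_left_of hx'.1 (by omega) (by have := hst q (by omega); omega)
    rw [hP] at h2
    rw [Finset.mem_filter, List.mem_toFinset]
    refine ⟨(List.mem_append.1 h2).resolve_left fun h3 => ?_, hx'.2⟩
    have h4 := hval₁ _ h3 _ List.mem_cons_self
    have h5 : A (i + 1) q ≤ A (i + 1) c := hA.antitone (i + 1) (by omega)
    simp only at h4
    omega
  have hsub₂ : (((c, A (i + 1) c - 1) :: P₂).toFinset.filter fun s => e s = i + 1) ⊆
      rowStrip (A (i + 1)) (A (i + 2)) (c + 1) (p + 1) := by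
    rintro ⟨q, j⟩ hx
    rw [Finset.mem_filter, List.mem_toFinset] at hx
    obtain ⟨hx, hxe⟩ := hx
    have h2 : (q, j) ∈ l₁ := by
      rw [hP]
      exact List.mem_append_right _ hx
    have h3 := (h.mem_snd q j).1 ⟨h.mem_of_left h2, hxe⟩
    have h4 := h.mem_left h2
    have hqp : q ≤ p := by
      by_contra hq
      obtain ⟨q, rfl⟩ : ∃ q', q = q' + 1 := ⟨q - 1, by omega⟩
      have h5 : A (i + 2) (q + 1) ≤ A (i + 1) q := hA.strip (i + 1) q
      have h6 : A (i + 1) q ≤ A (i + 1) p := hA.antitone (i + 1) (by omega)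
      omega
    have hqc : c < q := by
      by_contra hq
      have h5 : A (i + 1) c ≤ A (i + 1) q := hA.antitone (i + 1) (by omega)
      rcases List.mem_cons.1 hx with h6 | h6
      · rw [h6] at hxe
        omega
      · have h7 := (List.pairwise_cons.1 hval₂).1 _ h6
        simp only at h7
        omega
    rw [mem_rowStrip]
    omega
  have h1 := Finset.card_le_card hsub₁
  have h2 := Finset.card_le_card hsub₂
  have h4 := h.pot_sub_pot hc.le
  omega

theorem pot_le_of_antiDominant (h : IsSplitReading A i p e l₁ l₂)
    (hd : AntiDominant i (l₁.map e)) {c : ℕ} (hc : c ≤ p) :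
    IsPattern.pot A i c ≤ IsPattern.pot A i p := by
  induction hc using Nat.decreasingInduction with
  | self => exact le_rfl
  | of_succ c hc ih =>
    by_cases hlt : A i c < A (i + 1) c
    · exact h.pot_le_of_antiDominant_of_lt hd hc hlt
    · have h1 : IsPattern.pot A i (c + 1) =
          IsPattern.pot A i c + A (i + 2) (c + 1) - A (i + 1) (c + 1) - A (i + 1) c + A i c :=
        potential_succ (A i) (A (i + 1)) (A (i + 2)) c
      have h2 : A (i + 1) (c + 1) ≤ A (i + 2) (c + 1) := h.pattern.mono (i + 1) (c + 1)
      omega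

/-- Mirror image of `dominant_of_pot_lt`: (c, d) is the highest, then rightmost, i of the suffix,
and squares to the right of d in rows c and c + 1 compensate each other. -/
theorem antiDominant_of_pot_le (h : IsSplitReading A i p e l₁ l₂)
    (hK : ∀ c, c < p → IsPattern.pot A i c ≤ IsPattern.pot A i p) :
    AntiDominant i (l₁.map e) := by
  rintro u ⟨v, huv⟩
  obtain ⟨R, Q, hQ, -, rfl⟩ := List.map_eq_append_iff.1 huv.symm
  have hA := h.pattern
  have hval := h.valid_left
  have hnd : Q.Nodup := (List.nodup_append.1 (hQ ▸ h.nodup_left)).2.1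
  rw [hQ] at hval
  rw [count_map_eq_card hnd, count_map_eq_card hnd]
  have hQl : ∀ {x}, x ∈ Q → x ∈ l₁ := fun hx => hQ ▸ List.mem_append_right _ hx
  rcases (Q.toFinset.filter fun s => e s = i).eq_empty_or_nonempty with h0 | h0
  · rw [h0]
    simp
  obtain ⟨⟨c, d⟩, ht, hmin⟩ := Finset.exists_min_image _
    (fun s : ℕ × ℕ => toLex (s.1, -(s.2 : ℤ))) h0
  simp only [Finset.mem_filter, List.mem_toFinset, Prod.Lex.toLex_le_toLex] at ht hmin
  have htA := (h.mem_fst c d).1 ⟨h.mem_of_left (hQl ht.1), ht.2⟩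
  have hrow : ∀ {q j}, (q, j) ∈ Q → e (q, j) = i → q < p := fun {q j} hx hxe => by
    have h1 := h.mem_left (hQl hx)
    have h2 := (h.mem_fst q j).1 ⟨h.mem_of_left (hQl hx), hxe⟩
    by_contra hq
    have h3 : A (i + 1) q ≤ A (i + 1) p := hA.antitone (i + 1) (by omega)
    omega
  have hcp := hrow ht.1 ht.2
  have hsub₁ : (Q.toFinset.filter fun s => e s = i) ∪
      rowStrip (fun _ => d + 1) (A (i + 1)) c (c + 1) ⊆ rowStrip (A i) (A (i + 1)) c p := by
    rintro ⟨q, j⟩ hx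
    rw [Finset.mem_union, Finset.mem_filter, List.mem_toFinset, mem_rowStrip] at hx
    rw [mem_rowStrip]
    rcases hx with ⟨hx, hxe⟩ | hx
    · have h1 := hmin _ ⟨hx, hxe⟩
      have h2 := (h.mem_fst q j).1 ⟨h.mem_of_left (hQl hx), hxe⟩
      have h3 := hrow hx hxe
      simp only at h1
      omega
    · obtain rfl : q = c := by omega
      omega
  have hdisj : Disjoint (Q.toFinset.filter fun s => e s = i)
      (rowStrip (fun _ => d + 1) (A (i + 1)) c (c + 1)) := by
    rw [Finset.disjoint_left]
    rintro ⟨q, j⟩ hx hx'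
    rw [Finset.mem_filter, List.mem_toFinset] at hx
    rw [mem_rowStrip] at hx'
    have h1 := hmin _ hx
    simp only at h1
    omega
  have hsub₂ : rowStrip (A (i + 1)) (A (i + 2)) (c + 1) (p + 1) ⊆
      (Q.toFinset.filter fun s => e s = i + 1) ∪
        rowStrip (fun _ => d + 1) (fun _ => A (i + 1) c) (c + 1) (c + 1 + 1) := by
    rintro ⟨q, j⟩ hx
    rw [mem_rowStrip] at hx
    obtain ⟨hq, hx⟩ := hx
    rw [Finset.mem_union, Finset.mem_filter, List.mem_toFinset, mem_rowStrip]
    by_cases hj : j ≤ d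
    · left
      have hx' := (h.mem_snd q j).2 hx
      have h1 : A (i + 1) p ≤ A (i + 1) q := hA.antitone (i + 1) (by omega)
      have h2 := h.mem_left_of hx'.1 (by omega) (by omega)
      rw [hQ] at h2
      refine ⟨(List.mem_append.1 h2).resolve_left fun h3 => ?_, hx'.2⟩
      have h4 := (List.pairwise_append.1 hval).2.2 _ h3 _ ht.1
      simp only at h4
      omega
    · right
      obtain ⟨q, rfl⟩ : ∃ q', q = q' + 1 := ⟨q - 1, by omega⟩
      have h1 := hA.strip i c
      have h2 : A (i + 2) (q + 1) ≤ A (i + 1) q := hA.strip (i + 1) q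
      have h4 : q = c := by
        by_contra hqc
        have h5 : A (i + 1) q ≤ A (i + 1) (c + 1) := hA.antitone (i + 1) (by omega)
        omega
      subst h4
      omega
  have h1 := Finset.card_le_card hsub₁
  have h2 := (Finset.card_le_card hsub₂).trans (Finset.card_union_le _ _)
  have h4 := h.pot_sub_pot hcp.le
  have h5 := hK c hcp
  rw [Finset.card_union_of_disjoint hdisj, card_rowStrip (fun _ => d + 1)] at h1
  rw [card_rowStrip (fun _ => d + 1)] at h2
  simp at h1 h2
  omega

/-- The right-hand side involves no list: this is the independence of the reading order. -/
theorem dominant_iff (h : IsSplitReading A i p e l₁ l₂) :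
    AntiDominant i (l₁.map e) ∧ Dominant i (l₂.map e) ↔ IsLastMax (IsPattern.pot A i) p :=
  ⟨fun hd => ⟨fun _ hq => h.pot_le_of_antiDominant hd.1 hq.le,
    fun _ hq => h.pot_lt_of_dominant hd.2 hq⟩,
    fun hp => ⟨h.antiDominant_of_pot_le hp.1, h.dominant_of_pot_lt hp.2⟩⟩

end IsSplitReading

/-! ### Tableaux as patterns -/

namespace SkewTableau

variable {lam mu : YoungDiagram}

theorem exists_not_lt (T : SkewTableau lam mu) (k q : ℕ) :
    ∃ j, ¬ (j < lam.rowLen q ∧ (j < mu.rowLen q ∨ T.entry (q, j) < k)) :=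
  ⟨lam.rowLen q, fun h => lt_irrefl _ h.1⟩

/-- The pattern of a skew tableau: the number of squares in row `q` that lie in the inner shape
or have an entry smaller than `k`. -/
def pattern (T : SkewTableau lam mu) (k q : ℕ) : ℕ :=
  Nat.find (T.exists_not_lt k q)

/-- Weakly increasing rows make the counted squares an initial segment, so the first failing column
is their number. -/
theorem lt_pattern_iff (T : SkewTableau lam mu) {k q j : ℕ} :
    j < T.pattern k q ↔ j < lam.rowLen q ∧ (j < mu.rowLen q ∨ T.entry (q, j) < k) := by
  rw [pattern, Nat.lt_find_iff]
  simp only [not_not]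
  refine ⟨fun h => h j le_rfl, fun h m hm => ⟨by omega, ?_⟩⟩
  by_cases hmu : m < mu.rowLen q
  · exact Or.inl hmu
  · have := T.row_weak q m j hm (by rwa [YoungDiagram.mem_iff_lt_rowLen])
      (by rw [YoungDiagram.mem_iff_lt_rowLen]; exact h.1)
    omega

theorem pattern_iff (T : SkewTableau lam mu) {k q j : ℕ} :
    T.pattern k q ≤ j ∧ j < T.pattern (k + 1) q ↔
      ((q, j) ∈ lam ∧ (q, j) ∉ mu) ∧ T.entry (q, j) = k := by
  rw [← not_lt, lt_pattern_iff, lt_pattern_iff, YoungDiagram.mem_iff_lt_rowLen,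
    YoungDiagram.mem_iff_lt_rowLen]
  omega

theorem rowLen_le (T : SkewTableau lam mu) (q : ℕ) : mu.rowLen q ≤ lam.rowLen q := by
  refine le_of_forall_lt fun j hj => ?_
  rw [← YoungDiagram.mem_iff_lt_rowLen] at hj ⊢
  exact T.le hj

theorem pattern_zero (T : SkewTableau lam mu) : T.pattern 0 = mu.rowLen := by
  funext q
  refine eq_of_forall_lt_iff fun j => ?_
  have := T.rowLen_le q
  rw [lt_pattern_iff]
  omega

theorem exists_pattern_eq (T : SkewTableau lam mu) :
    ∃ K, ∀ k, K ≤ k → T.pattern k = lam.rowLen := by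
  refine ⟨lam.cells.sup T.entry + 1, fun k hk => ?_⟩
  funext q
  refine eq_of_forall_lt_iff fun j => ?_
  rw [lt_pattern_iff]
  refine ⟨fun h => h.1, fun h => ⟨h, Or.inr ?_⟩⟩
  rw [← YoungDiagram.mem_iff_lt_rowLen] at h
  have : T.entry (q, j) ≤ lam.cells.sup T.entry := Finset.le_sup ((YoungDiagram.mem_cells _).2 h)
  omega

theorem isPattern (T : SkewTableau lam mu) : IsPattern T.pattern where
  mono k q := by
    refine le_of_forall_lt fun j hj => ?_
    rw [lt_pattern_iff] at hj ⊢
    omega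
  strip k q := by
    refine le_of_forall_lt fun j hj => ?_
    rw [lt_pattern_iff] at hj ⊢
    have h1 : lam.rowLen (q + 1) ≤ lam.rowLen q := lam.rowLen_anti _ _ (Nat.le_succ q)
    have h2 : mu.rowLen (q + 1) ≤ mu.rowLen q := mu.rowLen_anti _ _ (Nat.le_succ q)
    refine ⟨by omega, ?_⟩
    by_cases hmu : j < mu.rowLen q
    · exact Or.inl hmu
    · have := T.col_strict q (q + 1) j (Nat.lt_succ_self q)
        (by rwa [YoungDiagram.mem_iff_lt_rowLen])
        (by rw [YoungDiagram.mem_iff_lt_rowLen]; exact hj.1)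
      omega
  stable := by
    obtain ⟨K, hK⟩ := T.exists_pattern_eq
    exact ⟨K, fun k hk => by rw [hK k hk, hK K le_rfl]⟩
  supp k := by
    refine ⟨lam.colLen 0, fun q hq => ?_⟩
    by_contra hne
    have h := ((T.lt_pattern_iff (k := k) (q := q) (j := 0)).1 (by omega)).1
    rw [← YoungDiagram.mem_iff_lt_rowLen, YoungDiagram.mem_iff_lt_colLen] at h
    omega

theorem filling_eq_fill (T : SkewTableau lam mu) : T.filling = fill T.pattern := by
  funext ⟨q, j⟩
  unfold filling
  split_ifs with h
  · rw [eq_comm]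
    exact (fill_eq_coe_iff T.isPattern).2 (T.pattern_iff.2 ⟨h, rfl⟩)
  · by_contra hne
    obtain ⟨m, hm⟩ := WithTop.ne_top_iff_exists.1 (Ne.symm hne)
    exact h (T.pattern_iff.1 ((fill_eq_coe_iff T.isPattern).1 hm.symm)).1

theorem isSkewFilling (T : SkewTableau lam mu) :
    IsSkewFilling T.filling mu.rowLen lam.rowLen := by
  have hval : ∀ q j, T.filling (q, j) ≠ ⊤ →
      ((q, j) ∈ lam ∧ (q, j) ∉ mu) ∧ T.filling (q, j) = (T.entry (q, j) : WithTop ℕ) := by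
    intro q j h
    unfold filling at h ⊢
    split_ifs at h ⊢ with hm
    · exact ⟨hm, rfl⟩
    · exact absurd rfl h
  refine ⟨fun q q' h => mu.rowLen_anti _ _ h, T.rowLen_le, fun q j => ?_, fun q j h1 h2 => ?_,
    fun q j h1 h2 => ?_⟩
  · unfold filling
    split_ifs with h <;> rw [YoungDiagram.mem_iff_lt_rowLen, YoungDiagram.mem_iff_lt_rowLen] at h
    · simp
      omega
    · simp
      omega
  · rw [(hval _ _ h1).2, (hval _ _ h2).2, Nat.cast_le]
    exact T.row_weak _ _ _ (Nat.le_succ j) (hval _ _ h1).1.2 (hval _ _ h2).1.1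
  · rw [(hval _ _ h1).2, (hval _ _ h2).2, Nat.cast_lt]
    exact T.col_strict _ _ _ (Nat.lt_succ_self q) (hval _ _ h1).1.2 (hval _ _ h2).1.1

/-- Every pattern of the right shape is the pattern of a tableau. -/
theorem exists_of_pattern {B : ℕ → ℕ → ℕ} (hB : IsPattern B) (h0 : B 0 = mu.rowLen) {K : ℕ}
    (hK : ∀ k, K ≤ k → B k = lam.rowLen) : ∃ U : SkewTableau lam mu, U.pattern = B := by
  have hmu : ∀ q j, (q, j) ∉ mu ↔ B 0 q ≤ j := fun q j => by
    rw [YoungDiagram.mem_iff_lt_rowLen, h0, not_lt]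
  have hlam : ∀ q j, (q, j) ∈ lam ↔ j < B K q := fun q j => by
    rw [YoungDiagram.mem_iff_lt_rowLen, hK K le_rfl]
  have hval : ∀ q j, B 0 q ≤ j → j < B K q →
      ∃ m : ℕ, fill B (q, j) = (m : WithTop ℕ) ∧ B m q ≤ j ∧ j < B (m + 1) q := by
    intro q j h1 h2
    obtain ⟨m, hm⟩ := WithTop.ne_top_iff_exists.1 (fill_ne_top hB h1 h2)
    exact ⟨m, hm.symm, (fill_eq_coe_iff hB).1 hm.symm⟩
  have hle : ∀ q, B 0 q ≤ B K q := fun q => hB.monotone q (Nat.zero_le K)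
  have hanti : ∀ k q q', q ≤ q' → B k q' ≤ B k q := fun k _ _ h => hB.antitone k h
  let U : SkewTableau lam mu :=
    { le := by
        rintro ⟨q, j⟩ h
        have h1 := YoungDiagram.mem_iff_lt_rowLen.1 h
        have h2 := hle q
        refine (hlam q j).2 ?_
        rw [← h0] at h1
        omega
      -- The default 0 meets the normalisation `zeros`.
      entry := fun s => (fill B s).untopD 0
      row_weak := by
        intro q j₁ j₂ hj h1 h2
        rw [hmu] at h1
        rw [hlam] at h2
        obtain ⟨m₁, e₁, h3, h4⟩ := hval q j₁ h1 (by omega)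
        obtain ⟨m₂, e₂, h5, h6⟩ := hval q j₂ (by omega) h2
        rw [e₁, e₂]
        change m₁ ≤ m₂
        by_contra hlt
        have : B (m₂ + 1) q ≤ B m₁ q := hB.monotone q (by omega)
        omega
      col_strict := by
        intro q₁ q₂ j hq h1 h2
        rw [hmu] at h1
        rw [hlam] at h2
        obtain ⟨m₁, e₁, h3, h4⟩ := hval q₁ j h1 (by have := hanti K q₁ q₂ hq.le; omega)
        obtain ⟨m₂, e₂, h5, h6⟩ := hval q₂ j (by have := hanti 0 q₁ q₂ hq.le; omega) h2
        rw [e₁, e₂]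
        change m₁ < m₂
        by_contra hlt
        obtain ⟨q, rfl⟩ : ∃ q, q₂ = q + 1 := ⟨q₂ - 1, by omega⟩
        have h7 := hB.strip m₂ q
        have h8 := hanti m₂ q₁ q (by omega)
        have h9 : B m₂ q₁ ≤ B m₁ q₁ := hB.monotone q₁ (by omega)
        omega
      zeros := by
        rintro ⟨q, j⟩ h
        rw [hlam, hmu] at h
        have : fill B (q, j) = ⊤ := by
          by_cases h1 : j < B 0 q
          · exact fill_eq_top_of_lt hB h1
          · exact fill_eq_top_of_le hB (K := K) (fun k hk => by rw [hK k hk, hK K le_rfl])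
              (by omega)
        rw [this]
        rfl }
  refine ⟨U, eq_of_fill_eq U.isPattern hB (by rw [U.pattern_zero, h0]) ?_⟩
  rw [← U.filling_eq_fill]
  funext ⟨q, j⟩
  unfold filling
  split_ifs with h
  · rw [hlam, hmu] at h
    obtain ⟨m, e, -⟩ := hval q j h.2 h.1
    change (((fill B (q, j)).untopD 0 : ℕ) : WithTop ℕ) = _
    rw [e]
    rfl
  · rw [hlam, hmu] at h
    rw [eq_comm]
    by_cases h1 : j < B 0 q
    · exact fill_eq_top_of_lt hB h1
    · exact fill_eq_top_of_le hB (K := K) (fun k hk => by rw [hK k hk, hK K le_rfl]) (by omega)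

theorem isSplitReading (T : SkewTableau lam mu) (r : ReadingOrder lam mu) {i p : ℕ}
    (hlt : T.pattern i p < T.pattern (i + 1) p) {l₁ l₂ : List (ℕ × ℕ)}
    (hr : r.squares = l₁ ++ (p, T.pattern (i + 1) p - 1) :: l₂) :
    IsSplitReading T.pattern i p T.entry l₁ l₂ where
  pattern := T.isPattern
  lt := hlt
  nodup := hr ▸ r.nodup
  valid := hr ▸ r.valid
  mem_fst q j := by rw [← hr, r.mem_squares, T.pattern_iff]
  mem_snd q j := by rw [← hr, r.mem_squares, ← T.pattern_iff]

/-- Increasing the entry `i` in a single square lowers the pattern. -/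
theorem pattern_eq_lowerAt {T U : SkewTableau lam mu} {i p c : ℕ}
    (hs : (p, c) ∈ lam ∧ (p, c) ∉ mu) (hT : T.entry (p, c) = i) (hU : U.entry (p, c) = i + 1)
    (hne : ∀ s, s ≠ (p, c) → U.entry s = T.entry s) :
    T.pattern (i + 1) p = c + 1 ∧ U.pattern = lowerAt T.pattern i p := by
  have hs' := hs
  rw [YoungDiagram.mem_iff_lt_rowLen, YoungDiagram.mem_iff_lt_rowLen] at hs'
  -- Another i to the right of the changed square would make the row of `U` decrease, so this square
  -- holds the last i of its row.
  have hc : T.pattern (i + 1) p = c + 1 := by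
    have h1 : c < T.pattern (i + 1) p := T.lt_pattern_iff.2 (by omega)
    by_contra h2
    have h3 := T.lt_pattern_iff.1 (show c + 1 < T.pattern (i + 1) p by omega)
    have h4 := U.row_weak p c (c + 1) (Nat.le_succ c) hs.2
      (YoungDiagram.mem_iff_lt_rowLen.2 h3.1)
    rw [hne (p, c + 1) (by simp)] at h4
    omega
  refine ⟨hc, ?_⟩
  funext k q
  refine eq_of_forall_lt_iff fun j => ?_
  rw [U.lt_pattern_iff, lowerAt]
  have hTlt := T.lt_pattern_iff (k := k) (q := q) (j := j)
  by_cases hsq : (q, j) = (p, c)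
  · obtain ⟨rfl, rfl⟩ := Prod.mk.inj hsq
    rw [hT] at hTlt
    rw [hU]
    split_ifs with h
    · obtain ⟨rfl, -⟩ := h
      omega
    · omega
  · rw [hne _ hsq]
    split_ifs with h
    · obtain ⟨rfl, rfl⟩ := h
      have : j ≠ c := fun hj => hsq (by rw [hj])
      omega
    · omega

theorem isLower_iff (r : ReadingOrder lam mu) (i : ℕ) (T U : SkewTableau lam mu) :
    IsLower r i T U ↔ Lowers i T.pattern U.pattern := by
  constructor
  · rintro ⟨u, v, hT, hU, hu, hv⟩
    obtain ⟨l₁, l', hr, rfl, hl'⟩ := List.map_eq_append_iff.1 hT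
    obtain ⟨⟨p, c⟩, l₂, rfl, hTs, rfl⟩ := List.map_eq_cons_iff.1 hl'
    unfold ReadingOrder.word at hU
    rw [hr, List.map_append, List.map_cons] at hU
    obtain ⟨hU₁, hU'⟩ := List.append_inj hU (by simp)
    obtain ⟨hUs, hU₂⟩ := List.cons.inj hU'
    have hs := (r.mem_squares (p, c)).1 (by rw [hr]; simp)
    have hne : ∀ s, s ≠ (p, c) → U.entry s = T.entry s := by
      intro s hs
      by_cases hm : s ∈ lam ∧ s ∉ mu
      · rw [← r.mem_squares, hr, List.mem_append, List.mem_cons] at hm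
        rcases hm with h | h | h
        · exact List.map_inj_left.1 hU₁ s h
        · exact absurd h hs
        · exact List.map_inj_left.1 hU₂ s h
      · rw [T.zeros s hm, U.zeros s hm]
    obtain ⟨hc, hpat⟩ := pattern_eq_lowerAt hs hTs hUs hne
    have hlt := T.pattern_iff.2 ⟨hs, hTs⟩
    have hsplit := T.isSplitReading r (i := i) (p := p) (by omega)
      (by rw [hc, Nat.add_sub_cancel]; exact hr)
    exact ⟨T.isPattern, p, hsplit.dominant_iff.1 ⟨hu, hv⟩, hpat⟩
  · rintro ⟨-, p, hp, hpat⟩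
    have hlt := (hp.lt T.isPattern).1
    have hTs := T.pattern_iff.1
      (show T.pattern i p ≤ T.pattern (i + 1) p - 1 ∧ _ < T.pattern (i + 1) p by omega)
    have hUs : U.entry (p, T.pattern (i + 1) p - 1) = i + 1 := by
      refine (U.pattern_iff.1 ?_).2
      have h1 := T.isPattern.mono (i + 1) p
      rw [hpat, lowerAt_self, if_pos rfl, lowerAt_of_ne _ _ _ (by omega)]
      omega
    have hne : ∀ s, s ≠ (p, T.pattern (i + 1) p - 1) → T.entry s = U.entry s := by
      rintro ⟨q, j⟩ hs
      by_cases hm : (q, j) ∈ lam ∧ (q, j) ∉ mu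
      · have h1 := T.pattern_iff.2 ⟨hm, rfl⟩
        refine (U.pattern_iff.1 ?_).2.symm
        rw [hpat]
        simp only [lowerAt]
        refine ⟨by omega, ?_⟩
        split_ifs with h
        · obtain ⟨h2, rfl⟩ := h
          rw [h2] at h1 ⊢
          have : j ≠ T.pattern (i + 1) q - 1 := fun hj => hs (by rw [hj])
          omega
        · omega
      · rw [T.zeros _ hm, U.zeros _ hm]
    obtain ⟨l₁, l₂, hr⟩ := List.append_of_mem ((r.mem_squares _).2 hTs.1)
    have hsplit := T.isSplitReading r hlt hr
    have hnd := r.nodup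
    rw [hr, List.nodup_append] at hnd
    obtain ⟨-, hnd₂, hnd₁⟩ := hnd
    obtain ⟨hu, hv⟩ := hsplit.dominant_iff.2 hp
    refine ⟨_, _, ?_, ?_, hu, hv⟩
    · rw [ReadingOrder.word, hr, List.map_append, List.map_cons, hTs.2]
    · rw [ReadingOrder.word, hr, List.map_append, List.map_cons, hUs,
        List.map_congr_left fun s hs => hne s (hnd₁ s hs _ List.mem_cons_self),
        List.map_congr_left fun s hs => hne s fun h => (List.nodup_cons.1 hnd₂).1 (h ▸ hs)]

end SkewTableau

/-! ### The commutation theorem -/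

/-- A relation between patterns that commutes with slides, changes neither the inner nor the outer
shape and is functional commutes with tableau switching. -/
theorem IsSwitch.compatible {R : (ℕ → ℕ → ℕ) → (ℕ → ℕ → ℕ) → Prop} (hR : SlideCompatible R)
    {m : ℕ} (hpat : ∀ {A B}, R A B → IsPattern B)
    (hshape : ∀ {A B}, R A B → ∀ k, k ≠ m + 1 → B k = A k)
    (hunique : ∀ {A B B'}, R A B → R A B' → B = B') {nu mu mu' lam : YoungDiagram}
    {S : SkewTableau mu nu} {T : SkewTableau lam mu} {T' : SkewTableau mu' nu}
    {S' : SkewTableau lam mu'} (hX : IsSwitch S T T' S') :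
    ((∃ U : SkewTableau lam mu, R T.pattern U.pattern) ↔
      ∃ U' : SkewTableau mu' nu, R T'.pattern U'.pattern) ∧
    ∀ (U : SkewTableau lam mu) (U' : SkewTableau mu' nu), R T.pattern U.pattern →
      R T'.pattern U'.pattern → IsSwitch S U U' S' := by
  have exists_tableau : ∀ {al be : YoungDiagram} (V : SkewTableau al be) {B},
      R V.pattern B → ∃ U : SkewTableau al be, U.pattern = B := by
    intro al be V B hB
    obtain ⟨K, hK⟩ := V.exists_pattern_eq
    -- Only row m + 1 of the pattern changes, so row 0 (the inner shape) and the rows from m + 2 on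
    -- (hence the outer shape) are kept.
    refine SkewTableau.exists_of_pattern (hpat hB) (K := K + m + 2) ?_ fun k hk => ?_
    · rw [hshape hB 0 (by omega), V.pattern_zero]
    · rw [hshape hB k (by omega), hK k (by omega)]
  obtain ⟨A', hA', hT', h0, hex, hcomm⟩ := FillingSwitch.compatible hR hX T.isPattern
    T.filling_eq_fill (T.pattern_zero ▸ S.isSkewFilling)
  -- A filling alone does not determine the inner shape; `h0` supplies it.
  obtain rfl : A' = T'.pattern := eq_of_fill_eq hA' T'.isPattern (by rw [h0, T'.pattern_zero])
    (by rw [← hT', T'.filling_eq_fill])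
  refine ⟨⟨?_, ?_⟩, fun U U' hU hU' => ?_⟩
  · rintro ⟨U, hU⟩
    obtain ⟨B', hB', -⟩ := hcomm _ hU
    obtain ⟨U', rfl⟩ := exists_tableau T' hB'
    exact ⟨U', hB'⟩
  · rintro ⟨U', hU'⟩
    obtain ⟨B, hB⟩ := hex ⟨_, hU'⟩
    obtain ⟨U, rfl⟩ := exists_tableau T hB
    exact ⟨U, hB⟩
  · obtain ⟨B', hB', hsw⟩ := hcomm _ hU
    obtain rfl := hunique hB' hU'
    rw [← U.filling_eq_fill, ← U'.filling_eq_fill] at hsw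
    exact hsw

theorem mainTheorem1 {nu mu mu' lam : YoungDiagram}
    (S : SkewTableau mu nu) (T : SkewTableau lam mu)
    (T' : SkewTableau mu' nu) (S' : SkewTableau lam mu')
    (hX : IsSwitch S T T' S') (i : ℕ)
    (r : ReadingOrder lam mu) (r' : ReadingOrder mu' nu) :
    (((∃ U, IsRaise r i T U) ↔ ∃ U', IsRaise r' i T' U') ∧
      ∀ U U', IsRaise r i T U → IsRaise r' i T' U' → IsSwitch S U U' S') ∧
    (((∃ U, IsLower r i T U) ↔ ∃ U', IsLower r' i T' U') ∧
      ∀ U U', IsLower r i T U → IsLower r' i T' U' → IsSwitch S U U' S') := by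
  have hraise : ∀ {al be : YoungDiagram} (ρ : ReadingOrder al be) (V W : SkewTableau al be),
      IsRaise ρ i V W ↔ Lowers i W.pattern V.pattern :=
    fun ρ V W => SkewTableau.isLower_iff ρ i W V
  simp only [hraise, SkewTableau.isLower_iff]
  exact ⟨IsSwitch.compatible (slideCompatible_raises i) (m := i) (fun h => h.1)
    (fun h k hk => (h.eq_of_ne hk).symm) (fun h h' => h.unique_left h') hX,
    IsSwitch.compatible (slideCompatible_lowers i) (m := i) (fun h => h.isPattern)
    (fun h k hk => h.eq_of_ne hk) (fun h h' => h.unique h') hX⟩
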